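/- Let $a<b$, let $(\Omega,\mathcal F,\mathbb P)$ be an atomless probability space (i.e. one carrying a random variable uniformly distributed on $[0,1]$), and let $\mathcal X_{[a,b]}$ be the set of random variables on it with values in $[a,b]$. "Increasing", "decreasing", "convex", "concave" are meant in the weak sense. For a distribution function $F$ put $F^{[1]}=F$ and $F^{[k]}(\eta)=\int_{-\infty}^{\eta}F^{[k-1]}(\xi)\,\mathrm d\xi$ for $k\ge2$. For $X,Y\in\mathcal X_{[a,b]}$ write $X\ge_n Y$ ($n$th-order stochastic dominance, $n$SD) if $F_X^{[n]}(\eta)\le F_Y^{[n]}(\eta)$ for all $\eta\in[a,b]$ and $F_X^{[k]}(b)\le F_Y^{[k]}(b)$ for $k=1,\dots,n$. A preference relation $\succsim$ on $\mathcal X_{[a,b]}$ is consistent with $n$SD if $X\succsim Y$ whenever $X\ge_n Y$. For a real random variable $Z$ write $\overline F_Z=1-F_Z$ and $\min Z=\inf\{x:F_Z(x)>0\}$ (the essential infimum). For $u:\mathbb R\to\mathbb R$ and an increasing $h:[0,1]\to[0,1]$ with $h(0)=0$ and $h(1)=1$, let $$R_{u,h}(X)=\int_0^\infty h(\overline F_{u(X)}(\eta))\,\mathrm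 d\eta+\int_{-\infty}^0\bigl(h(\overline F_{u(X)}(\eta))-1\bigr)\,\mathrm d\eta .$$ The relation $\succsim$ admits an RDU representation with $u$ and $h$ if $X\succsim Y\iff R_{u,h}(X)\ge R_{u,h}(Y)$ for all $X,Y\in\mathcal X_{[a,b]}$. For $n\ge2$, a function $f$ is $n$-monotone on $[a,b]$ if $f$ is increasing and concave on $[a,b]$, $f$ is $n-2$ times differentiable on $(a,b)$ with $(-1)^{k-1}f^{(k)}\ge0$ on $(a,b)$ for $k=1,\dots,n-2$, and $(-1)^{n-1}f^{(n-2)}$ is decreasing and convex on $(a,b)$. **Theorem.** Let $n\ge3$, and suppose that a preference relation $\succsim$ on $\mathcal X_{[a,b]}$ admits an RDU representation with $u$ and $h$ as above, where $u$ is nonconstant on $(a,b]$; no continuity or differentiability of $u$ or $h$ is assumed. Then $\succsim$ is consistent with $n$SD if and only if one of the following two cases holds. (i) $u$ is increasing on $[a,b]$ and $h(s)=\mathbf 1_{\{s=1\}}$ for all $s\in[0,1]$. In this case, $R_{u,h}(X)=\min u(X)$ for all $X\in\mathcal X_{[a,b]}$. (ii) $u$ is $n$-monotone on $[a,b]$ and,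 for some $\lambda\in(0,1]$, $h(s)=\lambda s\mathbf 1_{\{s<1\}}+\mathbf 1_{\{s=1\}}$ for all $s\in[0,1]$. In this case, $R_{u,h}(X)=\lambda\,\mathbb E[u(X)]+(1-\lambda)\min u(X)$ for all $X\in\mathcal X_{[a,b]}$. -/

import Mathlib

open Set MeasureTheory

noncomputable section

namespace RDU

/-- The distribution function `F_Y` of a real function `Y` on a probability space. -/
def distFun {Ω : Type*} [MeasurableSpace Ω] (P : Measure Ω) (Y : Ω → ℝ) (x : ℝ) : ℝ :=
  P.real {ω | Y ω ≤ x}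

/-- The survival function `1 - F_Y`. -/
def survFun {Ω : Type*} [MeasurableSpace Ω] (P : Measure Ω) (Y : Ω → ℝ) (x : ℝ) : ℝ :=
  1 - distFun P Y x

/-- The essential infimum `min(Y) = inf {x : F_Y(x) > 0}`. -/
def essMin {Ω : Type*} [MeasurableSpace Ω] (P : Measure Ω) (Y : Ω → ℝ) : ℝ :=
  sInf {x : ℝ | 0 < distFun P Y x}

/-- The random variables on `Ω` with values in `[a, b]`. -/
def RandVar (Ω : Type*) [MeasurableSpace Ω] (a b : ℝ) : Type _ :=
  {X : Ω → ℝ // Measurable X ∧ ∀ ω, X ω ∈ Icc a b}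

/-- The probability space carries a random variable that is uniformly distributed on `[0, 1]`
(for probability spaces this is the same as being atomless). -/
def SupportsUniform {Ω : Type*} [MeasurableSpace Ω] (P : Measure Ω) : Prop :=
  ∃ U : Ω → ℝ, Measurable U ∧ P.map U = volume.restrict (Icc (0 : ℝ) 1)

/-- `F^[n]`: `F^[1] = F` and `F^[n](η) = ∫_{-∞}^η F^[n-1](ξ) dξ` for `n ≥ 2`.
The index `0` is not used. -/
def iterDist (F : ℝ → ℝ) : ℕ → ℝ → ℝ
  | 0 => F
  | 1 => F
  | n + 2 => fun η => ∫ ξ in Iic η, iterDist F (n + 1) ξ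

/-- `X ≥_n Y`: (restricted) `n`-th order stochastic dominance on `[a, b]`. -/
def StochDom {Ω : Type*} [MeasurableSpace Ω] (P : Measure Ω) {a b : ℝ} (n : ℕ)
    (X Y : RandVar Ω a b) : Prop :=
  (∀ η ∈ Icc a b, iterDist (distFun P X.1) n η ≤ iterDist (distFun P Y.1) n η) ∧
  (∀ k ∈ Finset.Icc 1 n, iterDist (distFun P X.1) k b ≤ iterDist (distFun P Y.1) k b)

/-- A preference relation is consistent with `n`-th order stochastic dominance. -/
def Consistent {Ω : Type*} [MeasurableSpace Ω] (P : Measure Ω) {a b : ℝ} (n : ℕ)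
    (pref : RandVar Ω a b → RandVar Ω a b → Prop) : Prop :=
  ∀ X Y : RandVar Ω a b, StochDom P n X Y → pref X Y

/-- Probability weighting functions: increasing `h : [0,1] → [0,1]` with `h 0 = 0`, `h 1 = 1`.
Only the values of `h` on `[0, 1]` are relevant. -/
structure IsWeighting (h : ℝ → ℝ) : Prop where
  mapsTo : MapsTo h (Icc 0 1) (Icc 0 1)
  mono : MonotoneOn h (Icc 0 1)
  zero : h 0 = 0
  one : h 1 = 1

/-- The rank-dependent utility functional `R_{u,h}`. When `u` is increasing on `[a, b]`, `u(X)` is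
a bounded random variable and both integrals converge; for constant `X = c` the value is `u c`
for every `u`. -/
def rdu {Ω : Type*} [MeasurableSpace Ω] (P : Measure Ω) {a b : ℝ} (u h : ℝ → ℝ)
    (X : RandVar Ω a b) : ℝ :=
  (∫ η in Ioi (0 : ℝ), h (survFun P (fun ω => u (X.1 ω)) η)) +
    ∫ η in Iic (0 : ℝ), (h (survFun P (fun ω => u (X.1 ω)) η) - 1)

/-- The preference relation is represented by `R_{u,h}` (in particular, it is a weak order). -/
def AdmitsRDU {Ω : Type*} [MeasurableSpace Ω] (P : Measure Ω) {a b : ℝ}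
    (pref : RandVar Ω a b → RandVar Ω a b → Prop) (u h : ℝ → ℝ) : Prop :=
  ∀ X Y : RandVar Ω a b, pref X Y ↔ rdu P u h X ≥ rdu P u h Y

/-- `f` is `n`-monotone on `[a, b]` (`n ≥ 1`). For `n = 1`: `f` is increasing on `[a, b]`.
For `n ≥ 2`: `f` is increasing and concave on `[a, b]`, it is `n - 2` times differentiable on the
open interval with `(-1)^(k-1) f^(k) ≥ 0` there for `1 ≤ k ≤ n - 2`, and `(-1)^(n-1) f^(n-2)` is
decreasing and convex there. In the interior, monotonicity and concavity of `f` follow from the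
other conditions; at the end points they say that `f` may at most jump upwards at `a` and is
continuous at `b`. No derivative is required to exist at `a`. -/
def IsNMonotone (n : ℕ) (a b : ℝ) (f : ℝ → ℝ) : Prop :=
  MonotoneOn f (Icc a b) ∧
  (2 ≤ n →
    ConcaveOn ℝ (Icc a b) f ∧
    (∀ k ∈ Finset.Icc 1 (n - 2), ∀ x ∈ Ioo a b,
      DifferentiableAt ℝ (iteratedDeriv (k - 1) f) x ∧
        0 ≤ (-1 : ℝ) ^ (k - 1) * iteratedDeriv k f x) ∧
    AntitoneOn (fun x => (-1 : ℝ) ^ (n - 1) * iteratedDeriv (n - 2) f x) (Ioo a b) ∧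
    ConvexOn ℝ (Ioo a b) (fun x => (-1 : ℝ) ^ (n - 1) * iteratedDeriv (n - 2) f x))

/-- Case (i): `u` is increasing on `[a, b]` and `h(s) = 1_{s = 1}` on `[0, 1]`. -/
def CaseOne (a b : ℝ) (u h : ℝ → ℝ) : Prop :=
  MonotoneOn u (Icc a b) ∧ ∀ s ∈ Icc (0 : ℝ) 1, h s = if s = 1 then 1 else 0

/-- Case (ii) with parameter `l`: `l ∈ (0, 1]`, `u` is `n`-monotone on `[a, b]` and
`h(s) = l * s * 1_{s < 1} + 1_{s = 1}` on `[0, 1]`. -/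
def CaseTwo (n : ℕ) (a b : ℝ) (u h : ℝ → ℝ) (l : ℝ) : Prop :=
  l ∈ Ioc (0 : ℝ) 1 ∧ IsNMonotone n a b u ∧
    ∀ s ∈ Icc (0 : ℝ) 1, h s = l * s * (if s < 1 then 1 else 0) + (if s = 1 then 1 else 0)

end RDU

end

/-!
# Rank-dependent utility and higher-order stochastic dominance

Fubini's theorem turns `F^[k+1](η)` into the truncated moment `E[(η - X)₊ ^ k] / k!`, so that
dominance between finitely supported laws becomes a list of polynomial inequalities, and lower-order
dominance implies higher-order dominance (`StochDom.mono`).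

**Sufficiency.** When `h` is linear up to a jump at `1`, the functional is the mixture
`l E[u(X)] + (1 - l) min u(X)` (`rdu_eq_of_monotoneOn`), and both summands respect dominance. The
minimum does because the truncated moments at `η ↓ c` detect the mass of `(-∞, c]` once nothing lies
below `c` (`StochDom.essMin_le`). The expectation does because the derivative of an `n`-monotone `u`
is obtained from an antitone function by `n - 2` steps `w ↦ c + ∫_x^b w`; moving these tail
integrals onto the distribution function turns `E[u(b) - u(X)]` into an integral of the iterated
distribution function against a positive measure (`StochDom.integral_le`). The weights may blow up
at `a`, where `u` may jump, so this part works with extended nonnegative functions.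

**Necessity.** Everything rests on dominated pairs of finite laws.

* A mean-preserving spread gives an inequality between increments of `u` and of `h`
  (`Respects.spread`). No regularity is available, but averaging over the location of the spread
  inside a small scale differentiates `u`, and averaging over its rank differentiates `h`
  (`mul_le_mul_of_increments`). This makes `h` convex, and `u` concave unless `h = 0` on `[0, 1)`.
* A spread of size `t` at the upper ranks may be offset, to third order, by a contraction with the
  same variance at the lower ranks (`Respects.transfer`). A strictly convex `h` charges an amount of
  order `t` for the former, whereas the latter gains only `O(t ^ 2)`, since its mass is of order
  `t ^ 2`. Hence the second differences of `h` vanish and `h` is linear on `[0, 1)`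
  (`Respects.weighting_midpoint`, `Respects.dichotomy`).
* If `h` has positive slope, put a common atom at `a` into both laws; the minimum terms cancel and
  the comparison is one of expected utilities (`Respects.signed_sum_nonneg`). Testing with forward
  differences of convexity gaps shows that these alternate in sign for `-u` (`Respects.altConvex`).
  One such difference can be traded for one derivative: the right derivative of a function in this
  class is concave, so it is continuous, so it is the derivative (`AltConvex.hasDeriv`). Induction
  yields `n`-monotonicity (`isNMonotone_of_altConvex`).
-/

noncomputable section

namespace RDU

open Filter Topology
open scoped ENNReal

variable {Ω : Type*} [MeasurableSpace Ω] {P : Measure Ω}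

/-! ### Iterated distribution functions as truncated moments -/

lemma distFun_nonneg (Y : Ω → ℝ) (x : ℝ) : 0 ≤ distFun P Y x := measureReal_nonneg

lemma distFun_le_one [IsProbabilityMeasure P] (Y : Ω → ℝ) (x : ℝ) : distFun P Y x ≤ 1 :=
  measureReal_le_one

lemma distFun_mono [IsFiniteMeasure P] (Y : Ω → ℝ) : Monotone (distFun P Y) := fun _ _ h =>
  measureReal_mono fun _ hω => le_trans hω h

lemma distFun_eq_zero {Y : Ω → ℝ} {x : ℝ} (h : ∀ ω, x < Y ω) : distFun P Y x = 0 := by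
  have : {ω | Y ω ≤ x} = ∅ := by
    ext ω; simpa using h ω
  simp [distFun, this]

lemma distFun_eq_one [IsProbabilityMeasure P] {Y : Ω → ℝ} {x : ℝ} (h : ∀ ω, Y ω ≤ x) :
    distFun P Y x = 1 := by
  have : {ω | Y ω ≤ x} = univ := by
    ext ω; simpa using h ω
  simp [distFun, this]

lemma ofReal_distFun [IsFiniteMeasure P] (Y : Ω → ℝ) (x : ℝ) :
    ENNReal.ofReal (distFun P Y x) = P {ω | Y ω ≤ x} := by
  simp [distFun]

/-- The truncated power `y₊ ^ k / k!`, the kernel of `k`-fold iterated integration. -/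
def tpow (k : ℕ) (y : ℝ) : ℝ := (max y 0) ^ k / (k.factorial : ℝ)

lemma tpow_nonneg (k : ℕ) (y : ℝ) : 0 ≤ tpow k y := by unfold tpow; positivity

lemma continuous_tpow (k : ℕ) : Continuous (tpow k) := by unfold tpow; fun_prop

lemma tpow_mono (k : ℕ) : Monotone (tpow k) := fun x y h => by unfold tpow; gcongr

lemma tpow_of_nonpos {k : ℕ} (hk : k ≠ 0) {y : ℝ} (hy : y ≤ 0) : tpow k y = 0 := by
  simp [tpow, max_eq_right hy, hk]

lemma tpow_of_nonneg (k : ℕ) {y : ℝ} (hy : 0 ≤ y) : tpow k y = y ^ k / (k.factorial : ℝ) := by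
  simp [tpow, max_eq_left hy]

lemma tpow_one (y : ℝ) : tpow 1 y = max y 0 := by simp [tpow]

lemma hasDerivAt_tpow_sub {k : ℕ} (hk : 1 ≤ k) (η x : ℝ) :
    HasDerivAt (fun x => tpow (k + 1) (η - x)) (-tpow k (η - x)) x := by
  have key : ∀ y, HasDerivAt (tpow (k + 1)) (tpow k y) y := by
    have hf : ((k + 1).factorial : ℝ) = (k + 1) * k.factorial := by
      rw [Nat.factorial_succ]; push_cast; ring
    have hfk : (k.factorial : ℝ) ≠ 0 := by positivity
    intro y
    rcases lt_trichotomy y 0 with hy | rfl | hy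
    · rw [tpow_of_nonpos (by omega) hy.le]
      refine (hasDerivAt_const y (0 : ℝ)).congr_of_eventuallyEq ?_
      filter_upwards [Iio_mem_nhds hy] with z hz
      exact tpow_of_nonpos (by omega) (le_of_lt hz)
    · rw [tpow_of_nonpos (by omega) le_rfl, hasDerivAt_iff_isLittleO]
      have h1 : (fun z : ℝ => z ^ (k + 1)) =o[𝓝 0] fun z : ℝ => z := by
        simpa using Asymptotics.isLittleO_pow_pow (𝕜 := ℝ) (show 1 < k + 1 by omega)
      refine Asymptotics.IsBigO.trans_isLittleO ?_ (by simpa using h1)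
      refine Asymptotics.IsBigO.of_bound 1 (Eventually.of_forall fun z => ?_)
      rw [tpow_of_nonpos (by omega) le_rfl]
      simp only [sub_zero, smul_zero, Real.norm_eq_abs, one_mul, abs_pow]
      rw [abs_of_nonneg (tpow_nonneg _ _)]
      unfold tpow
      calc (max z 0) ^ (k + 1) / ((k + 1).factorial : ℝ) ≤ (max z 0) ^ (k + 1) :=
            div_le_self (by positivity) (by exact_mod_cast Nat.factorial_pos (k + 1))
        _ ≤ |z| ^ (k + 1) := by
            gcongr
            exact max_le (le_abs_self z) (abs_nonneg z)
    · rw [tpow_of_nonneg k hy.le]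
      have h := ((hasDerivAt_pow (k + 1) y).div_const ((k + 1).factorial : ℝ))
      refine (h.congr_of_eventuallyEq ?_).congr_deriv ?_
      · filter_upwards [Ioi_mem_nhds hy] with z hz
        exact tpow_of_nonneg _ (le_of_lt hz)
      · rw [hf, Nat.add_sub_cancel]; push_cast; field_simp
  have := (key (η - x)).comp x ((hasDerivAt_id x).const_sub η)
  simpa [Function.comp_def] using this

lemma lintegral_Iic_tpow (k : ℕ) (hk : k ≠ 0) (η x : ℝ) :
    ∫⁻ ξ in Iic η, ENNReal.ofReal (tpow k (ξ - x)) = ENNReal.ofReal (tpow (k + 1) (η - x)) := by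
  have hzero : ∀ ξ ≤ x, tpow k (ξ - x) = 0 := fun ξ hξ => tpow_of_nonpos hk (by linarith)
  rcases le_total η x with h | h
  · rw [tpow_of_nonpos (by omega) (by linarith)]
    rw [setLIntegral_congr_fun measurableSet_Iic (g := fun _ => 0)]
    · simp
    · intro ξ hξ
      simp only [hzero ξ (le_trans hξ h), ENNReal.ofReal_zero]
  · rw [← Iic_union_Ioc_eq_Iic h, lintegral_union (A := Iic x) measurableSet_Ioc
      (Set.disjoint_left.2 fun y hy hy' => not_lt.2 hy hy'.1)]
    rw [setLIntegral_congr_fun (s := Iic x) measurableSet_Iic (g := fun _ => 0)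
      (fun ξ hξ => by simp only [hzero ξ hξ, ENNReal.ofReal_zero])]
    have hint : IntervalIntegrable (fun ξ => tpow k (ξ - x)) volume x η :=
      ((continuous_tpow k).comp (continuous_id.sub continuous_const)).intervalIntegrable _ _
    rw [← ofReal_integral_eq_lintegral_ofReal
      ((intervalIntegrable_iff_integrableOn_Ioc_of_le h).1 hint)
      (Eventually.of_forall fun _ => tpow_nonneg _ _),
      ← intervalIntegral.integral_of_le h]
    have : ∫ ξ in x..η, tpow k (ξ - x) = ∫ ξ in x..η, (ξ - x) ^ k / (k.factorial : ℝ) := by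
      refine intervalIntegral.integral_congr fun ξ hξ => ?_
      rw [uIcc_of_le h] at hξ
      exact tpow_of_nonneg _ (by linarith [hξ.1])
    rw [this, intervalIntegral.integral_comp_sub_right (fun y => y ^ k / (k.factorial : ℝ)) x,
      intervalIntegral.integral_div, integral_pow, tpow_of_nonneg _ (by linarith : 0 ≤ η - x)]
    simp only [lintegral_zero, zero_add, sub_self]
    congr 1
    rw [Nat.factorial_succ]
    push_cast
    rw [zero_pow (by omega)]
    field_simp
    ring

/-- Truncated moments of a bounded random variable are integrable. -/
lemma integrable_tpow [IsFiniteMeasure P] {X : Ω → ℝ} (hX : Measurable X) {a : ℝ}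
    (ha : ∀ ω, a ≤ X ω) (k : ℕ) (η : ℝ) : Integrable (fun ω => tpow k (η - X ω)) P := by
  refine Integrable.of_bound (C := tpow k (η - a)) ?_ (Eventually.of_forall fun ω => ?_)
  · exact ((continuous_tpow k).measurable.comp (measurable_const.sub hX)).aestronglyMeasurable
  · rw [Real.norm_eq_abs, abs_of_nonneg (tpow_nonneg _ _)]
    exact tpow_mono k (by linarith [ha ω])

lemma lintegral_Iic_distFun [IsFiniteMeasure P] {X : Ω → ℝ} (hX : Measurable X) (η : ℝ) :
    ∫⁻ ξ in Iic η, ENNReal.ofReal (distFun P X ξ) = ∫⁻ ω, ENNReal.ofReal (tpow 1 (η - X ω)) ∂P := by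
  have hm : MeasurableSet {p : ℝ × Ω | X p.2 ≤ p.1} :=
    measurableSet_le (hX.comp measurable_snd) measurable_fst
  have h1 : ∀ ξ, ENNReal.ofReal (distFun P X ξ)
      = ∫⁻ ω, {p : ℝ × Ω | X p.2 ≤ p.1}.indicator (fun _ => 1) (ξ, ω) ∂P := by
    intro ξ
    rw [ofReal_distFun, ← lintegral_indicator_one (measurableSet_le hX measurable_const)]
    rfl
  simp_rw [h1]
  rw [lintegral_lintegral_swap (f := fun ξ ω =>
    {p : ℝ × Ω | X p.2 ≤ p.1}.indicator (fun _ => (1 : ENNReal)) (ξ, ω))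
    (measurable_const.indicator hm).aemeasurable]
  refine lintegral_congr fun ω => ?_
  have h2 : ∀ ξ, {p : ℝ × Ω | X p.2 ≤ p.1}.indicator (fun _ => (1 : ENNReal)) (ξ, ω)
      = (Ici (X ω)).indicator 1 ξ := fun ξ => rfl
  simp_rw [h2]
  rw [lintegral_indicator_one measurableSet_Ici, Measure.restrict_apply measurableSet_Ici,
    Ici_inter_Iic, Real.volume_Icc, tpow_one]
  rcases le_total 0 (η - X ω) with h | h
  · rw [max_eq_left h]
  · rw [max_eq_right h, ENNReal.ofReal_of_nonpos h, ENNReal.ofReal_zero]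

/-- Fubini: `F^[k+2](η) = E[(η - X)₊ ^ (k+1)] / (k+1)!`. -/
theorem iterDist_eq [IsFiniteMeasure P] {X : Ω → ℝ} (hX : Measurable X) {a : ℝ}
    (ha : ∀ ω, a ≤ X ω) (k : ℕ) (η : ℝ) :
    iterDist (distFun P X) (k + 2) η = ∫ ω, tpow (k + 1) (η - X ω) ∂P := by
  induction k generalizing η with
  | zero =>
    change ∫ ξ in Iic η, distFun P X ξ = _
    rw [integral_eq_lintegral_of_nonneg_ae (Eventually.of_forall (distFun_nonneg X))
      (distFun_mono X).measurable.aestronglyMeasurable, lintegral_Iic_distFun hX,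
      integral_eq_lintegral_of_nonneg_ae (Eventually.of_forall fun _ => tpow_nonneg _ _)
      (integrable_tpow hX ha _ _).aestronglyMeasurable]
  | succ k ih =>
    change ∫ ξ in Iic η, iterDist (distFun P X) (k + 2) ξ = _
    have hmono : Monotone fun ξ => ∫ ω, tpow (k + 1) (ξ - X ω) ∂P := fun ξ ξ' h =>
      integral_mono (integrable_tpow hX ha _ _) (integrable_tpow hX ha _ _)
        fun ω => tpow_mono _ (by linarith)
    simp_rw [ih]
    rw [integral_eq_lintegral_of_nonneg_ae
      (Eventually.of_forall fun _ => integral_nonneg fun _ => tpow_nonneg _ _)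
      hmono.measurable.aestronglyMeasurable,
      integral_eq_lintegral_of_nonneg_ae (Eventually.of_forall fun _ => tpow_nonneg _ _)
      (integrable_tpow hX ha _ _).aestronglyMeasurable]
    simp_rw [ofReal_integral_eq_lintegral_ofReal (integrable_tpow hX ha _ _)
      (Eventually.of_forall fun _ => tpow_nonneg _ _)]
    rw [lintegral_lintegral_swap]
    · simp_rw [lintegral_Iic_tpow (k + 1) (by omega)]
    · have : Measurable fun p : ℝ × Ω => tpow (k + 1) (p.1 - X p.2) :=
        (continuous_tpow _).measurable.comp (measurable_fst.sub (hX.comp measurable_snd))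
      exact this.ennreal_ofReal.aemeasurable

section Bounded

variable [IsFiniteMeasure P] {X : Ω → ℝ} (hX : Measurable X) {a : ℝ} (ha : ∀ ω, a ≤ X ω)

include hX ha

lemma iterDist_nonneg (k : ℕ) (η : ℝ) : 0 ≤ iterDist (distFun P X) (k + 1) η := by
  cases k with
  | zero => exact distFun_nonneg X η
  | succ k => rw [iterDist_eq hX ha]; exact integral_nonneg fun _ => tpow_nonneg _ _

lemma iterDist_mono (k : ℕ) : Monotone (iterDist (distFun P X) (k + 1)) := by
  cases k with
  | zero => exact distFun_mono X
  | succ k =>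
    intro ξ ξ' h
    rw [iterDist_eq hX ha, iterDist_eq hX ha]
    exact integral_mono (integrable_tpow hX ha _ _) (integrable_tpow hX ha _ _)
        fun ω => tpow_mono _ (by linarith)

lemma iterDist_eq_zero (k : ℕ) {η : ℝ} (hη : η < a) : iterDist (distFun P X) (k + 1) η = 0 := by
  cases k with
  | zero => exact distFun_eq_zero fun ω => hη.trans_le (ha ω)
  | succ k =>
    rw [iterDist_eq hX ha]
    simp_rw [fun ω => tpow_of_nonpos (Nat.succ_ne_zero k) (show η - X ω ≤ 0 by linarith [ha ω])]
    simp

lemma iterDist_integrableOn (k : ℕ) (η : ℝ) :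
    IntegrableOn (iterDist (distFun P X) (k + 1)) (Iic η) := by
  have h1 : IntegrableOn (iterDist (distFun P X) (k + 1)) (Iio a) :=
    (integrableOn_zero (ε' := ℝ)).congr_fun (fun ξ hξ => (iterDist_eq_zero hX ha k hξ).symm)
      measurableSet_Iio
  have h2 : IntegrableOn (iterDist (distFun P X) (k + 1)) (Icc a η) :=
    ((iterDist_mono hX ha k).monotoneOn _).integrableOn_isCompact isCompact_Icc
  refine (h1.union h2).mono_set fun x hx => ?_
  rcases lt_or_ge x a with h | h
  · exact Or.inl h
  · exact Or.inr ⟨h, hx⟩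

lemma ofReal_iterDist_succ (k : ℕ) (η : ℝ) :
    ENNReal.ofReal (iterDist (distFun P X) (k + 2) η)
      = ∫⁻ ξ in Iic η, ENNReal.ofReal (iterDist (distFun P X) (k + 1) ξ) := by
  change ENNReal.ofReal (∫ ξ in Iic η, iterDist (distFun P X) (k + 1) ξ) = _
  exact ofReal_integral_eq_lintegral_ofReal (iterDist_integrableOn hX ha k η)
    (Eventually.of_forall (iterDist_nonneg hX ha k))

end Bounded

/-- Dominance is inherited by higher orders. -/
lemma StochDom.mono [IsFiniteMeasure P] {a b : ℝ} {k n : ℕ} (hk : 1 ≤ k) (hkn : k ≤ n)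
    {X Y : RandVar Ω a b} (h : StochDom P k X Y) : StochDom P n X Y := by
  induction n, hkn using Nat.le_induction with
  | base => exact h
  | succ n hn ih =>
    obtain ⟨m, rfl⟩ : ∃ m, n = m + 1 := ⟨n - 1, by omega⟩
    have hX := fun ω => (X.2.2 ω).1
    have hY := fun ω => (Y.2.2 ω).1
    have key : ∀ η ∈ Icc a b, iterDist (distFun P X.1) (m + 2) η
        ≤ iterDist (distFun P Y.1) (m + 2) η := by
      intro η hη
      refine setIntegral_mono_on (iterDist_integrableOn X.2.1 hX m η)
        (iterDist_integrableOn Y.2.1 hY m η) measurableSet_Iic fun ξ hξ => ?_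
      rcases lt_or_ge ξ a with h' | h'
      · rw [iterDist_eq_zero X.2.1 hX m h', iterDist_eq_zero Y.2.1 hY m h']
      · exact ih.1 ξ ⟨h', le_trans hξ hη.2⟩
    refine ⟨key, fun j hj => ?_⟩
    rw [Finset.mem_Icc] at hj
    rcases Nat.lt_or_ge j (m + 2) with hj' | hj'
    · exact ih.2 j (Finset.mem_Icc.2 ⟨hj.1, by omega⟩)
    · obtain rfl : j = m + 2 := by omega
      rcases le_or_gt a b with hab | hab
      · exact key b ⟨hab, le_rfl⟩
      · rw [iterDist_eq_zero X.2.1 hX _ hab, iterDist_eq_zero Y.2.1 hY _ hab]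

/-! ### The rank-dependent utility functional on bounded random variables -/

lemma survFun_mem [IsProbabilityMeasure P] (Y : Ω → ℝ) (x : ℝ) : survFun P Y x ∈ Icc (0 : ℝ) 1 :=
  ⟨by have := distFun_le_one (P := P) Y x; unfold survFun; linarith,
    by have := distFun_nonneg (P := P) Y x; unfold survFun; linarith⟩

lemma survFun_anti [IsFiniteMeasure P] (Y : Ω → ℝ) : Antitone (survFun P Y) := fun _ _ h =>
  sub_le_sub_left (distFun_mono Y h) 1

lemma IsWeighting.antitone_survFun [IsProbabilityMeasure P] {h : ℝ → ℝ} (hh : IsWeighting h)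
    (Y : Ω → ℝ) : Antitone fun η => h (survFun P Y η) := fun _ _ hη =>
  hh.mono (survFun_mem Y _) (survFun_mem Y _) (survFun_anti Y hη)

/-- For `u(X)` with values in `[A, B]`, the two improper integrals in `R_{u,h}` reduce to one
over `[A, B]`. -/
theorem rdu_eq_integral [IsProbabilityMeasure P] {a b : ℝ} {u h : ℝ → ℝ} (hh : IsWeighting h)
    (X : RandVar Ω a b) {A B : ℝ} (hA : ∀ ω, A ≤ u (X.1 ω)) (hB : ∀ ω, u (X.1 ω) ≤ B) :
    rdu P u h X = A + ∫ η in A..B, h (survFun P (fun ω => u (X.1 ω)) η) := by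
  set φ : ℝ → ℝ := fun η => h (survFun P (fun ω => u (X.1 ω)) η) with hφ
  have hanti : Antitone φ := hh.antitone_survFun _
  have hint : ∀ c d, IntervalIntegrable φ volume c d := fun c d =>
    (hanti.antitoneOn _).intervalIntegrable
  have h1 : ∀ η < A, φ η = 1 := fun η hη => by
    simp only [hφ, survFun]
    rw [distFun_eq_zero fun ω => hη.trans_le (hA ω), sub_zero, hh.one]
  have h0 : ∀ η, B ≤ η → φ η = 0 := fun η hη => by
    simp only [hφ, survFun]
    rw [distFun_eq_one fun ω => (hB ω).trans hη, sub_self, hh.zero]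
  obtain ⟨M, hM0, hMA, hMB⟩ : ∃ M : ℝ, 0 ≤ M ∧ -M < A ∧ B ≤ M :=
    ⟨max |A| |B| + 1, by positivity,
      by have := neg_abs_le A; have := le_max_left |A| |B|; linarith,
      by have := le_abs_self B; have := le_max_right |A| |B|; linarith⟩
  have e1 : ∫ η in Ioi (0 : ℝ), φ η = ∫ η in (0 : ℝ)..M, φ η := by
    rw [intervalIntegral.integral_of_le hM0]
    refine setIntegral_eq_of_subset_of_forall_sdiff_eq_zero measurableSet_Ioi
      Ioc_subset_Ioi_self fun x hx => h0 x (hMB.trans ?_)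
    by_contra hlt
    exact hx.2 ⟨hx.1, (not_le.1 hlt).le⟩
  have e2 : ∫ η in Iic (0 : ℝ), (φ η - 1) = ∫ η in (-M)..0, (φ η - 1) := by
    rw [intervalIntegral.integral_of_le (by linarith)]
    refine setIntegral_eq_of_subset_of_forall_sdiff_eq_zero measurableSet_Iic
      Ioc_subset_Iic_self fun x hx => ?_
    have : x ≤ -M := by
      by_contra hlt
      exact hx.2 ⟨not_le.1 hlt, hx.1⟩
    rw [h1 x (by linarith), sub_self]
  have e3 : ∫ η in (-M)..A, φ η = A + M := by
    have : ∫ η in (-M)..A, φ η = ∫ η in (-M)..A, (1 : ℝ) := by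
      rw [intervalIntegral.integral_of_le hMA.le, intervalIntegral.integral_of_le hMA.le,
        integral_Ioc_eq_integral_Ioo, integral_Ioc_eq_integral_Ioo]
      exact setIntegral_congr_fun measurableSet_Ioo fun x hx => h1 x hx.2
    rw [this]; simp
  have e4 : ∫ η in B..M, φ η = 0 := by
    rw [intervalIntegral.integral_congr (g := fun _ => (0 : ℝ))]
    · simp
    · intro x hx
      rw [uIcc_of_le hMB] at hx
      exact h0 x hx.1
  have hsum : ∫ η in (-M)..M, φ η = (∫ η in (-M)..0, φ η) + ∫ η in (0 : ℝ)..M, φ η :=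
    (intervalIntegral.integral_add_adjacent_intervals (hint _ _) (hint _ _)).symm
  have hsum' : ∫ η in (-M)..M, φ η
      = (∫ η in (-M)..A, φ η) + (∫ η in A..B, φ η) + ∫ η in B..M, φ η := by
    rw [intervalIntegral.integral_add_adjacent_intervals (hint _ _) (hint _ _),
      intervalIntegral.integral_add_adjacent_intervals (hint _ _) (hint _ _)]
  change (∫ η in Ioi (0 : ℝ), φ η) + ∫ η in Iic (0 : ℝ), (φ η - 1) = _
  rw [e1, e2, intervalIntegral.integral_sub (hint _ _) (by simp)]
  simp only [intervalIntegral.integral_const, smul_eq_mul]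
  linarith

section EssMin

variable [IsProbabilityMeasure P] {Y : Ω → ℝ} {A B : ℝ}
  (hA : ∀ ω, A ≤ Y ω) (hB : ∀ ω, Y ω ≤ B)

include hA

omit [IsProbabilityMeasure P] in
lemma bddBelow_distFun_pos : BddBelow {x | 0 < distFun P Y x} := by
  refine ⟨A, fun x hx => ?_⟩
  by_contra h
  exact (ne_of_gt hx) (distFun_eq_zero fun ω => (not_le.1 h).trans_le (hA ω))

omit [IsProbabilityMeasure P] in
lemma distFun_eq_zero_of_lt_essMin {x : ℝ} (hx : x < essMin P Y) : distFun P Y x = 0 := by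
  by_contra h
  have : 0 < distFun P Y x := lt_of_le_of_ne (distFun_nonneg _ _) (Ne.symm h)
  exact absurd (csInf_le (bddBelow_distFun_pos hA) this) (not_le.2 hx)

include hB

omit hA in
lemma distFun_pos_nonempty : {x | 0 < distFun P Y x}.Nonempty :=
  ⟨B, by rw [mem_ofPred_eq, distFun_eq_one hB]; exact one_pos⟩

omit hA in
lemma distFun_pos_of_essMin_lt {x : ℝ} (hx : essMin P Y < x) : 0 < distFun P Y x := by
  obtain ⟨y, hy, hyx⟩ := exists_lt_of_csInf_lt (distFun_pos_nonempty hB) hx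
  exact lt_of_lt_of_le hy (distFun_mono _ hyx.le)

lemma le_essMin : A ≤ essMin P Y := by
  refine le_csInf (distFun_pos_nonempty hB) fun x hx => ?_
  by_contra h
  exact (ne_of_gt hx) (distFun_eq_zero fun ω => (not_le.1 h).trans_le (hA ω))

lemma essMin_le : essMin P Y ≤ B := csInf_le (bddBelow_distFun_pos hA)
  (by rw [mem_ofPred_eq, distFun_eq_one hB]; exact one_pos)

lemma integral_survFun (hY : Measurable Y) (hAB : A ≤ B) :
    ∫ η in A..B, survFun P Y η = (∫ ω, Y ω ∂P) - A := by
  have hF : IntervalIntegrable (distFun P Y) volume A B :=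
    ((distFun_mono Y).monotoneOn _).intervalIntegrable
  have hYi : Integrable Y P := Integrable.of_bound (C := max |A| |B|) hY.aestronglyMeasurable
    (Eventually.of_forall fun ω => abs_le_max_abs_abs (hA ω) (hB ω))
  have e1 : ∫ η in A..B, distFun P Y η = B - ∫ ω, Y ω ∂P := by
    have h2 := iterDist_eq (P := P) hY hA 0 B
    change ∫ ξ in Iic B, distFun P Y ξ = _ at h2
    rw [intervalIntegral.integral_of_le hAB, ← integral_Icc_eq_integral_Ioc]
    have : ∫ η in Icc A B, distFun P Y η = ∫ ξ in Iic B, distFun P Y ξ := by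
      symm
      refine setIntegral_eq_of_subset_of_forall_sdiff_eq_zero measurableSet_Iic
        Icc_subset_Iic_self fun x hx => distFun_eq_zero fun ω => lt_of_lt_of_le ?_ (hA ω)
      by_contra hlt
      exact hx.2 ⟨not_lt.1 hlt, hx.1⟩
    rw [this, h2]
    have : ∀ ω, tpow (0 + 1) (B - Y ω) = B - Y ω := fun ω => by
      rw [zero_add, tpow_one, max_eq_left (by linarith [hB ω])]
    simp_rw [this]
    rw [integral_sub (integrable_const _) hYi]
    simp
  simp only [survFun]
  rw [intervalIntegral.integral_sub (by simp) hF, e1]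
  simp

lemma integral_indicator_survFun_one :
    ∫ η in A..B, (if survFun P Y η = 1 then (1 : ℝ) else 0) = essMin P Y - A := by
  have h1 := le_essMin (P := P) hA hB
  have h2 := essMin_le (P := P) hA hB
  set φ : ℝ → ℝ := fun η => if survFun P Y η = 1 then (1 : ℝ) else 0 with hφ
  have hlt : ∀ η < essMin P Y, φ η = 1 := fun η hη => by
    simp [hφ, survFun, distFun_eq_zero_of_lt_essMin hA hη]
  have hgt : ∀ η, essMin P Y < η → φ η = 0 := fun η hη => by
    have := distFun_pos_of_essMin_lt (P := P) hB hη
    simp [hφ, survFun, this.ne']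
  have hanti : Antitone φ := by
    intro x y hxy
    by_cases hy : survFun P Y y = 1
    · have : survFun P Y x = 1 := le_antisymm (survFun_mem Y x).2 (hy ▸ survFun_anti Y hxy)
      simp [hφ, hy, this]
    · simp only [hφ, hy, if_false]
      split_ifs <;> norm_num
  have hint : ∀ c d, IntervalIntegrable φ volume c d := fun c d =>
    (hanti.antitoneOn _).intervalIntegrable
  rw [← intervalIntegral.integral_add_adjacent_intervals (hint A (essMin P Y)) (hint _ B)]
  have e1 : ∫ η in A..(essMin P Y), φ η = ∫ η in A..(essMin P Y), (1 : ℝ) := by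
    rw [intervalIntegral.integral_of_le h1, intervalIntegral.integral_of_le h1,
        integral_Ioc_eq_integral_Ioo, integral_Ioc_eq_integral_Ioo]
    exact setIntegral_congr_fun measurableSet_Ioo fun x hx => hlt x hx.2
  have e2 : ∫ η in (essMin P Y)..B, φ η = 0 := by
    rw [intervalIntegral.integral_of_le h2]
    exact setIntegral_eq_zero_of_forall_eq_zero fun x hx => hgt x hx.1
  rw [e1, e2]; simp

end EssMin

/-- For a weighting function that is linear up to a jump at `1`, the functional is a mixture of
the expectation and the essential infimum. -/
theorem rdu_eq_mixture [IsProbabilityMeasure P] {a b : ℝ} {u h : ℝ → ℝ} (hh : IsWeighting h)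
    {l : ℝ} (hl : ∀ s ∈ Icc (0 : ℝ) 1, h s = l * s + (1 - l) * (if s = 1 then 1 else 0))
    (X : RandVar Ω a b) (hm : Measurable fun ω => u (X.1 ω)) {A B : ℝ}
    (hA : ∀ ω, A ≤ u (X.1 ω)) (hB : ∀ ω, u (X.1 ω) ≤ B) (hAB : A ≤ B) :
    rdu P u h X = l * (∫ ω, u (X.1 ω) ∂P) + (1 - l) * essMin P (fun ω => u (X.1 ω)) := by
  rw [rdu_eq_integral hh X hA hB]
  set Y := fun ω => u (X.1 ω)
  have e : ∀ η, h (survFun P Y η)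
      = l * survFun P Y η + (1 - l) * (if survFun P Y η = 1 then 1 else 0) := fun η =>
    hl _ (survFun_mem Y η)
  simp_rw [e]
  have i1 : IntervalIntegrable (survFun P Y) volume A B :=
    ((survFun_anti Y).antitoneOn _).intervalIntegrable
  have i2 : IntervalIntegrable (fun η => if survFun P Y η = 1 then (1 : ℝ) else 0) volume A B := by
    refine AntitoneOn.intervalIntegrable (Antitone.antitoneOn (fun x y hxy => ?_) _)
    by_cases hy : survFun P Y y = 1
    · have : survFun P Y x = 1 := le_antisymm (survFun_mem Y x).2 (hy ▸ survFun_anti Y hxy)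
      simp [hy, this]
    · simp only [hy, if_false]
      split_ifs <;> norm_num
  rw [intervalIntegral.integral_add (i1.const_mul _) (i2.const_mul _),
    intervalIntegral.integral_const_mul, intervalIntegral.integral_const_mul,
    integral_survFun hA hB hm hAB, integral_indicator_survFun_one hA hB]
  ring

lemma CaseOne.weighting_eq {a b : ℝ} {u h : ℝ → ℝ} (hc : CaseOne a b u h) :
    ∀ s ∈ Icc (0 : ℝ) 1, h s = 0 * s + (1 - 0) * (if s = 1 then 1 else 0) := by
  intro s hs
  rw [hc.2 s hs]; ring

lemma CaseTwo.weighting_eq {n : ℕ} {a b : ℝ} {u h : ℝ → ℝ} {l : ℝ} (hc : CaseTwo n a b u h l) :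
    ∀ s ∈ Icc (0 : ℝ) 1, h s = l * s + (1 - l) * (if s = 1 then 1 else 0) := by
  intro s hs
  rw [hc.2.2 s hs]
  rcases hs.2.lt_or_eq with h' | h'
  · simp [h', h'.ne]
  · simp [h']

section MonotoneUtility

variable {a b : ℝ} {u : ℝ → ℝ}

lemma measurable_comp_randVar (hu : MonotoneOn u (Icc a b)) (X : RandVar Ω a b) :
    Measurable fun ω => u (X.1 ω) := by
  rcases isEmpty_or_nonempty Ω with hΩ | ⟨⟨ω₀⟩⟩
  · exact measurable_of_empty _
  have hab : a ≤ b := (X.2.2 ω₀).1.trans (X.2.2 ω₀).2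
  have hext : Monotone (IccExtend hab (fun x : Icc a b => u x)) :=
    Monotone.IccExtend (f := fun x : Icc a b => u x) hab fun x y h => hu x.2 y.2 h
  have : (fun ω => u (X.1 ω)) = IccExtend hab (fun x : Icc a b => u x) ∘ X.1 := by
    funext ω
    simp [IccExtend_of_mem hab (fun x : Icc a b => u x) (X.2.2 ω)]
  rw [this]
  exact hext.measurable.comp X.2.1

lemma le_comp_randVar (hu : MonotoneOn u (Icc a b)) (X : RandVar Ω a b) (ω : Ω) :
    u a ≤ u (X.1 ω) :=
  hu (left_mem_Icc.2 ((X.2.2 ω).1.trans (X.2.2 ω).2)) (X.2.2 ω) (X.2.2 ω).1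

lemma comp_randVar_le (hu : MonotoneOn u (Icc a b)) (X : RandVar Ω a b) (ω : Ω) :
    u (X.1 ω) ≤ u b :=
  hu (X.2.2 ω) (right_mem_Icc.2 ((X.2.2 ω).1.trans (X.2.2 ω).2)) (X.2.2 ω).2

theorem rdu_eq_of_monotoneOn [IsProbabilityMeasure P] (hab : a ≤ b) {h : ℝ → ℝ}
    (hh : IsWeighting h) (hu : MonotoneOn u (Icc a b)) {l : ℝ}
    (hl : ∀ s ∈ Icc (0 : ℝ) 1, h s = l * s + (1 - l) * (if s = 1 then 1 else 0))
    (X : RandVar Ω a b) :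
    rdu P u h X = l * (∫ ω, u (X.1 ω) ∂P) + (1 - l) * essMin P (fun ω => u (X.1 ω)) :=
  rdu_eq_mixture hh hl X (measurable_comp_randVar hu X) (le_comp_randVar hu X)
    (comp_randVar_le hu X) (hu (left_mem_Icc.2 hab) (right_mem_Icc.2 hab) hab)

end MonotoneUtility

/-! ### Random variables with finitely many values -/

/-- A space carrying a uniform random variable carries every finite distribution. -/
theorem SupportsUniform.exists_weights (hP : SupportsUniform P) {ι : Type*} [Fintype ι]
    [Nonempty ι] (p : ι → ℝ) (hp : ∀ i, 0 ≤ p i) (hp1 : ∑ i, p i = 1) :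
    ∃ Z : Ω → ι, (∀ s : Set ι, MeasurableSet (Z ⁻¹' s)) ∧
      (∀ s : Set ι, P.real (Z ⁻¹' s) = ∑ i, s.indicator p i) ∧
      ∀ f : ι → ℝ, ∫ ω, f (Z ω) ∂P = ∑ i, p i * f i := by
  let _ : MeasurableSpace ι := ⊤
  have : DiscreteMeasurableSpace ι := ⟨fun _ => trivial⟩
  obtain ⟨U, hU, hmap⟩ := hP
  set μ : Measure ι := ∑ i, ENNReal.ofReal (p i) • Measure.dirac i with hμ
  have hμs : ∀ s : Set ι, μ s = ∑ i, ENNReal.ofReal (s.indicator p i) := by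
    intro s
    rw [hμ, Measure.finsetSum_apply]
    refine Finset.sum_congr rfl fun i _ => ?_
    by_cases hi : i ∈ s <;> simp [hi]
  have hpos : ∀ s : Set ι, ∀ i, 0 ≤ s.indicator p i := fun s i =>
    indicator_nonneg (fun i _ => hp i) i
  have hμr : ∀ s : Set ι, μ.real s = ∑ i, s.indicator p i := by
    intro s
    rw [measureReal_def, hμs, ← ENNReal.ofReal_sum_of_nonneg fun i _ => hpos s i,
      ENNReal.toReal_ofReal (Finset.sum_nonneg fun i _ => hpos s i)]
  have : IsProbabilityMeasure μ := ⟨by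
    rw [hμs, ← ENNReal.ofReal_sum_of_nonneg fun i _ => hpos univ i]
    simp [hp1]⟩
  obtain ⟨f, hf, hfμ⟩ := μ.exists_measurable_map_eq
  have hproj : Measurable (projIcc (0 : ℝ) 1 zero_le_one) := continuous_projIcc.measurable
  have hvol : (volume : Measure (Icc (0 : ℝ) 1)) = (P.map U).map (projIcc 0 1 zero_le_one) := by
    rw [hmap, ← map_comap_subtype_coe measurableSet_Icc, Measure.map_map hproj
      measurable_subtype_coe]
    have : projIcc (0 : ℝ) 1 zero_le_one ∘ Subtype.val = id := by
      funext x; simp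
    rw [this, Measure.map_id]
    rfl
  set Z : Ω → ι := fun ω => f (projIcc 0 1 zero_le_one (U ω)) with hZ
  have hZm : Measurable Z := hf.comp (hproj.comp hU)
  have hZμ : P.map Z = μ := by
    rw [← hfμ, hvol, Measure.map_map hproj hU, Measure.map_map hf (hproj.comp hU)]
    rfl
  refine ⟨Z, fun s => hZm trivial, fun s => ?_, fun g => ?_⟩
  · rw [← hμr, ← hZμ, map_measureReal_apply hZm trivial]
  · rw [← integral_map hZm.aemeasurable (by fun_prop), hZμ, integral_fintype
      (Integrable.of_finite)]
    refine Finset.sum_congr rfl fun i _ => ?_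
    classical
    rw [hμr, smul_eq_mul, Finset.sum_eq_single i (fun j _ hj => by simp [hj]) (by simp)]
    simp

/-- The value of `R_{u,h}` at a random variable with utility levels `v 0 ≤ v 1 ≤ …`. -/
theorem rdu_eq_sum [IsProbabilityMeasure P] {a b : ℝ} {u h : ℝ → ℝ} (hh : IsWeighting h)
    (X : RandVar Ω a b) {m : ℕ} (Z : Ω → Fin (m + 1)) {v : Fin (m + 1) → ℝ} (hv : Monotone v)
    (hX : ∀ ω, u (X.1 ω) = v (Z ω)) (hZ : ∀ s, MeasurableSet (Z ⁻¹' s)) :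
    rdu P u h X = v 0 + ∑ i : Fin m, (v i.succ - v i.castSucc) * h (P.real (Z ⁻¹' Ici i.succ)) := by
  rw [rdu_eq_integral hh X (A := v 0) (B := v (Fin.last m))
    (fun ω => by rw [hX]; exact hv (Fin.zero_le _)) (fun ω => by rw [hX]; exact hv (Fin.le_last _))]
  congr 1
  set φ : ℝ → ℝ := fun η => h (survFun P (fun ω => u (X.1 ω)) η) with hφ
  have hanti : Antitone φ := hh.antitone_survFun _
  have hint : ∀ c d, IntervalIntegrable φ volume c d := fun c d =>
    (hanti.antitoneOn _).intervalIntegrable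
  have hval : ∀ i : Fin m, ∀ η ∈ Ico (v i.castSucc) (v i.succ),
      φ η = h (P.real (Z ⁻¹' Ici i.succ)) := by
    intro i η hη
    simp only [hφ, survFun, distFun]
    congr 1
    have : Z ⁻¹' Ici i.succ = {ω | u (X.1 ω) ≤ η}ᶜ := by
      ext ω
      simp only [mem_preimage, mem_Ici, mem_compl_iff, mem_ofPred_eq, hX, not_le]
      constructor
      · intro hi
        exact hη.2.trans_le (hv hi)
      · intro hlt
        by_contra hi
        have : Z ω ≤ i.castSucc := by
          rw [not_le] at hi
          exact Fin.le_castSucc_iff.2 hi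
        exact absurd (hv this) (not_le.2 (hη.1.trans_lt hlt))
    have hm : MeasurableSet {ω | u (X.1 ω) ≤ η} := by
      rw [← compl_compl {ω | u (X.1 ω) ≤ η}, ← this]
      exact (hZ _).compl
    rw [this, probReal_compl_eq_one_sub hm]
  set w : ℕ → ℝ := fun k => v ⟨min k m, by omega⟩ with hw
  have hsum := intervalIntegral.sum_integral_adjacent_intervals (a := w) (f := φ) (μ := volume)
    (n := m) fun k _ => hint _ _
  have hw0 : w 0 = v 0 := by simp [hw]
  have hwm : w m = v (Fin.last m) := by simp only [hw, min_self]; rfl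
  rw [hw0, hwm] at hsum
  rw [← hsum, Finset.sum_range]
  refine Finset.sum_congr rfl fun i _ => ?_
  have e1 : w i = v i.castSucc := by
    simp only [hw]; congr 1; ext; simp
  have e2 : w (i + 1) = v i.succ := by
    simp only [hw]; congr 1; ext; simp
  have hle : v i.castSucc ≤ v i.succ := hv (Fin.castSucc_lt_succ).le
  rw [e1, e2, intervalIntegral.integral_of_le hle, integral_Ioc_eq_integral_Ioo,
    setIntegral_congr_fun measurableSet_Ioo fun η hη => hval i η ⟨hη.1.le, hη.2⟩]
  simp [hle]

/-- Dominance between finite distributions on common points, in terms of truncated moments. -/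
theorem exists_stochDom [IsProbabilityMeasure P] (hP : SupportsUniform P) {a b : ℝ} {ι : Type*}
    [Fintype ι] [Nonempty ι] (x : ι → ℝ) (hx : ∀ i, x i ∈ Icc a b) (p q : ι → ℝ)
    (hp : ∀ i, 0 ≤ p i) (hp1 : ∑ i, p i = 1) (hq : ∀ i, 0 ≤ q i) (hq1 : ∑ i, q i = 1)
    {k : ℕ} (hk : 2 ≤ k)
    (hdom : ∀ η ∈ Icc a b, ∑ i, p i * tpow (k - 1) (η - x i) ≤ ∑ i, q i * tpow (k - 1) (η - x i))
    (hb : ∀ j ∈ Finset.Icc 1 (k - 1),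
      ∑ i, p i * tpow j (b - x i) ≤ ∑ i, q i * tpow j (b - x i)) :
    ∃ (X Y : RandVar Ω a b) (Z W : Ω → ι), StochDom P k X Y ∧
      (∀ ω, X.1 ω = x (Z ω)) ∧ (∀ ω, Y.1 ω = x (W ω)) ∧
      (∀ s, MeasurableSet (Z ⁻¹' s)) ∧ (∀ s, MeasurableSet (W ⁻¹' s)) ∧
      (∀ s, P.real (Z ⁻¹' s) = ∑ i, s.indicator p i) ∧
      (∀ s, P.real (W ⁻¹' s) = ∑ i, s.indicator q i) ∧
      (∀ f : ι → ℝ, ∫ ω, f (Z ω) ∂P = ∑ i, p i * f i) ∧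
      (∀ f : ι → ℝ, ∫ ω, f (W ω) ∂P = ∑ i, q i * f i) := by
  obtain ⟨Z, hZ, hZr, hZi⟩ := hP.exists_weights p hp hp1
  obtain ⟨W, hW, hWr, hWi⟩ := hP.exists_weights q hq hq1
  have hZm : Measurable fun ω => x (Z ω) := fun s _ => hZ (x ⁻¹' s)
  have hWm : Measurable fun ω => x (W ω) := fun s _ => hW (x ⁻¹' s)
  have hZa : ∀ ω, a ≤ x (Z ω) := fun ω => (hx _).1
  have hWa : ∀ ω, a ≤ x (W ω) := fun ω => (hx _).1
  refine ⟨⟨fun ω => x (Z ω), hZm, fun ω => hx _⟩, ⟨fun ω => x (W ω), hWm, fun ω => hx _⟩, Z, W,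
    ⟨fun η hη => ?_, fun j hj => ?_⟩, fun _ => rfl, fun _ => rfl, hZ, hW, hZr, hWr, hZi, hWi⟩
  · obtain ⟨m, rfl⟩ : ∃ m, k = m + 2 := ⟨k - 2, by omega⟩
    rw [iterDist_eq hZm hZa, iterDist_eq hWm hWa, hZi (fun i => tpow (m + 1) (η - x i)),
      hWi (fun i => tpow (m + 1) (η - x i))]
    exact hdom η hη
  · rw [Finset.mem_Icc] at hj
    rcases Nat.lt_or_ge j 2 with h | h
    · obtain rfl : j = 1 := by omega
      change distFun P _ b ≤ distFun P _ b
      rw [distFun_eq_one fun ω => (hx (Z ω)).2, distFun_eq_one fun ω => (hx (W ω)).2]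
    · obtain ⟨m, rfl⟩ : ∃ m, j = m + 2 := ⟨j - 2, by omega⟩
      rw [iterDist_eq hZm hZa, iterDist_eq hWm hWa, hZi (fun i => tpow (m + 1) (b - x i)),
        hWi (fun i => tpow (m + 1) (b - x i))]
      exact hb (m + 1) (Finset.mem_Icc.2 ⟨by omega, by omega⟩)

/-! ### Stochastic dominance and the essential infimum -/

lemma distFun_continuousWithinAt [IsProbabilityMeasure P] {Y : Ω → ℝ} (hY : Measurable Y) (c : ℝ) :
    ContinuousWithinAt (distFun P Y) (Ioi c) c := by
  have : IsProbabilityMeasure (P.map Y) := Measure.isProbabilityMeasure_map hY.aemeasurable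
  have h1 : distFun P Y = ProbabilityTheory.cdf (P.map Y) := by
    funext x
    rw [ProbabilityTheory.cdf_eq_real, map_measureReal_apply hY measurableSet_Iic]
    rfl
  rw [h1]
  exact ((ProbabilityTheory.cdf (P.map Y)).right_continuous c).mono Ioi_subset_Ici_self

/-- Below the support of the dominated variable, dominance compares the first atoms: this
follows from the behaviour of the truncated moments at `η ↓ c`. -/
lemma StochDom.distFun_le [IsProbabilityMeasure P] {a b : ℝ} {n : ℕ} (hn : 2 ≤ n)
    {X Y : RandVar Ω a b} (h : StochDom P n X Y) {c : ℝ} (hc : c ∈ Ico a b)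
    (hYc : P {ω | Y.1 ω < c} = 0) : distFun P X.1 c ≤ distFun P Y.1 c := by
  obtain ⟨k, rfl⟩ : ∃ k, n = k + 2 := ⟨n - 2, by omega⟩
  have hXa : ∀ ω, a ≤ X.1 ω := fun ω => (X.2.2 ω).1
  have hYa : ∀ ω, a ≤ Y.1 ω := fun ω => (Y.2.2 ω).1
  have key : ∀ η ∈ Ioc c b, distFun P X.1 c ≤ distFun P Y.1 η := by
    intro η hη
    have h1 := h.1 η ⟨hc.1.trans hη.1.le, hη.2⟩
    rw [iterDist_eq X.2.1 hXa, iterDist_eq Y.2.1 hYa] at h1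
    have hpos : 0 < tpow (k + 1) (η - c) := by
      rw [tpow_of_nonneg _ (by linarith [hη.1])]
      have : 0 < η - c := by linarith [hη.1]
      positivity
    have mX : MeasurableSet {ω | X.1 ω ≤ c} := measurableSet_le X.2.1 measurable_const
    have mY : MeasurableSet {ω | Y.1 ω ≤ η} := measurableSet_le Y.2.1 measurable_const
    have e1 : tpow (k + 1) (η - c) * distFun P X.1 c ≤ ∫ ω, tpow (k + 1) (η - X.1 ω) ∂P := by
      have : ∫ ω, {ω | X.1 ω ≤ c}.indicator (fun _ => tpow (k + 1) (η - c)) ω ∂P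
          = tpow (k + 1) (η - c) * distFun P X.1 c := by
        rw [integral_indicator_const _ mX, smul_eq_mul, mul_comm]; rfl
      rw [← this]
      refine integral_mono ((integrable_const _).indicator mX) (integrable_tpow X.2.1 hXa _ _)
        fun ω => ?_
      by_cases hω : X.1 ω ≤ c
      · rw [indicator_of_mem (by exact hω)]
        exact tpow_mono _ (by linarith)
      · rw [indicator_of_notMem (by exact hω)]
        exact tpow_nonneg _ _
    have e2 : ∫ ω, tpow (k + 1) (η - Y.1 ω) ∂P ≤ tpow (k + 1) (η - c) * distFun P Y.1 η := by
      have : ∫ ω, {ω | Y.1 ω ≤ η}.indicator (fun _ => tpow (k + 1) (η - c)) ω ∂P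
          = tpow (k + 1) (η - c) * distFun P Y.1 η := by
        rw [integral_indicator_const _ mY, smul_eq_mul, mul_comm]; rfl
      rw [← this]
      have hae : ∀ᵐ ω ∂P, c ≤ Y.1 ω := by
        rw [ae_iff]; simpa using hYc
      refine integral_mono_ae (integrable_tpow Y.2.1 hYa _ _)
        ((integrable_const _).indicator mY) ?_
      filter_upwards [hae] with ω hωc
      by_cases hω : Y.1 ω ≤ η
      · rw [indicator_of_mem (by exact hω)]
        exact tpow_mono _ (by linarith)
      · rw [indicator_of_notMem (by exact hω), tpow_of_nonpos (by omega) (by linarith)]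
    exact le_of_mul_le_mul_left (e1.trans (h1.trans e2)) hpos
  refine ge_of_tendsto (distFun_continuousWithinAt Y.2.1 c) ?_
  filter_upwards [Ioc_mem_nhdsGT hc.2] with η hη using key η hη

/-- Dominance of order at least two raises the essential infimum, also after an increasing and
possibly discontinuous transformation. -/
theorem StochDom.essMin_le [IsProbabilityMeasure P] {a b : ℝ} {n : ℕ} (hn : 2 ≤ n) {u : ℝ → ℝ}
    (hu : MonotoneOn u (Icc a b)) {X Y : RandVar Ω a b} (h : StochDom P n X Y) :
    essMin P (fun ω => u (Y.1 ω)) ≤ essMin P (fun ω => u (X.1 ω)) := by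
  refine csInf_le_csInf (bddBelow_distFun_pos (le_comp_randVar hu Y))
    (distFun_pos_nonempty (comp_randVar_le hu X)) fun x hx => ?_
  by_contra hY
  have hY0 : P {ω | u (Y.1 ω) ≤ x} = 0 := by
    have : distFun P (fun ω => u (Y.1 ω)) x = 0 :=
      le_antisymm (not_lt.1 hY) (distFun_nonneg _ _)
    rw [← ofReal_distFun, this, ENNReal.ofReal_zero]
  have hx' : 0 < distFun P (fun ω => u (X.1 ω)) x := hx
  refine hx'.ne' ?_
  have goal : P {ω | u (X.1 ω) ≤ x} = 0 → distFun P (fun ω => u (X.1 ω)) x = 0 := fun h0 => by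
    simp [distFun, measureReal_def, h0]
  apply goal
  set D : Set ℝ := {c ∈ Icc a b | u c ≤ x} with hD
  have hXD : {ω | u (X.1 ω) ≤ x} = X.1 ⁻¹' D := by
    ext ω; simp [hD, (X.2.2 ω).1, (X.2.2 ω).2]
  -- at each point `c` of the lower set `D`, `Y > c` almost surely, hence `X > c` almost surely
  have hnull : ∀ c ∈ D, P {ω | X.1 ω ≤ c} = 0 := by
    intro c hc
    have hYc : P {ω | Y.1 ω ≤ c} = 0 := measure_mono_null
      (fun ω hω => (hu (Y.2.2 ω) hc.1 hω).trans hc.2) hY0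
    rcases hc.1.2.lt_or_eq with hcb | rfl
    · have h1 := h.distFun_le hn ⟨hc.1.1, hcb⟩
        (measure_mono_null (fun ω (hω : Y.1 ω < c) => le_of_lt hω) hYc)
      rw [← ofReal_distFun, ENNReal.ofReal_eq_zero] at hYc ⊢
      exact h1.trans hYc
    · have : {ω | Y.1 ω ≤ c} = univ := by
        ext ω; simpa using (Y.2.2 ω).2
      rw [this] at hYc
      simp at hYc
  rw [hXD]
  rcases D.eq_empty_or_nonempty with hDe | hDne
  · simp [hDe]
  have hDb : BddAbove D := ⟨b, fun c hc => hc.1.2⟩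
  by_cases hs : sSup D ∈ D
  · exact measure_mono_null (fun ω hω => le_csSup hDb hω) (hnull _ hs)
  · obtain ⟨s, -, hs1, hs2⟩ := exists_seq_tendsto_sSup hDne hDb
    refine measure_mono_null (t := ⋃ i, {ω | X.1 ω ≤ s i}) (fun ω hω => ?_)
      (measure_iUnion_null fun i => hnull _ (hs2 i))
    have hlt : X.1 ω < sSup D := lt_of_le_of_ne (le_csSup hDb hω) fun he => hs (he ▸ hω)
    obtain ⟨i, hi⟩ := (hs1.eventually (lt_mem_nhds hlt)).exists
    exact mem_iUnion.2 ⟨i, hi.le⟩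

/-! ### Iterated tail integrals -/

/-- The cone of functions on `(a, b)` obtained from an antitone function by `m` steps of the form
`w ↦ c + ∫_x^b w`. Extended nonnegative values allow a singularity at `a`. -/
def IterTail (a b : ℝ) : ℕ → (ℝ → ℝ≥0∞) → Prop
  | 0, w => ∃ w₀ : ℝ → ℝ, AntitoneOn w₀ (Ioo a b) ∧
      ∀ x ∈ Ioo a b, 0 ≤ w₀ x ∧ w x = ENNReal.ofReal (w₀ x)
  | m + 1, w => ∃ (c : ℝ≥0∞) (w' : ℝ → ℝ≥0∞), IterTail a b m w' ∧
      ∀ x ∈ Ioo a b, w x = c + ∫⁻ z in Ioo x b, w' z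

lemma IterTail.antitoneOn {a b : ℝ} {m : ℕ} {w : ℝ → ℝ≥0∞} (hw : IterTail a b m w) :
    AntitoneOn w (Ioo a b) := by
  cases m with
  | zero =>
    obtain ⟨w₀, h1, h2⟩ := hw
    intro x hx y hy hxy
    rw [(h2 x hx).2, (h2 y hy).2]
    exact ENNReal.ofReal_le_ofReal (h1 hx hy hxy)
  | succ m =>
    obtain ⟨c, w', -, h2⟩ := hw
    intro x hx y hy hxy
    rw [h2 x hx, h2 y hy]
    gcongr

lemma IterTail.aemeasurable {a b : ℝ} {m : ℕ} {w : ℝ → ℝ≥0∞} (hw : IterTail a b m w) :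
    AEMeasurable w (volume.restrict (Ioo a b)) :=
  aemeasurable_restrict_of_antitoneOn measurableSet_Ioo hw.antitoneOn

/-- Tonelli's theorem on the triangle `y < z` moves a tail integral from one factor to the other. -/
lemma lintegral_tail_mul {a b : ℝ} {w F : ℝ → ℝ≥0∞}
    (hw : AEMeasurable w (volume.restrict (Ioo a b))) (hF : Measurable F) :
    ∫⁻ y in Ioo a b, (∫⁻ z in Ioo y b, w z) * F y
      = ∫⁻ z in Ioo a b, w z * ∫⁻ y in Ioo a z, F y := by
  set μ := (volume.restrict (Ioo a b) : Measure ℝ) with hμ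
  have hm : MeasurableSet {p : ℝ × ℝ | p.1 < p.2} := measurableSet_lt measurable_fst measurable_snd
  set K : ℝ → ℝ → ℝ≥0∞ := fun y z => {p : ℝ × ℝ | p.1 < p.2}.indicator (fun p => w p.2 * F p.1)
    (y, z) with hK
  have hKm : AEMeasurable (Function.uncurry K) (μ.prod μ) := by
    have : AEMeasurable (fun p : ℝ × ℝ => w p.2 * F p.1) (μ.prod μ) :=
      (hw.comp_quasiMeasurePreserving Measure.quasiMeasurePreserving_snd).mul
        (hF.comp measurable_fst).aemeasurable
    exact this.indicator hm
  have e1 : ∀ y ∈ Ioo a b, ∫⁻ z, K y z ∂μ = (∫⁻ z in Ioo y b, w z) * F y := by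
    intro y hy
    have : ∀ z, K y z = (Ioi y).indicator (fun z => w z * F y) z := fun z => rfl
    simp_rw [this]
    rw [lintegral_indicator measurableSet_Ioi, hμ, Measure.restrict_restrict measurableSet_Ioi,
      Ioi_inter_Ioo, max_eq_left hy.1.le]
    rw [lintegral_mul_const'']
    exact hw.mono_measure (Measure.restrict_mono (Ioo_subset_Ioo_left hy.1.le) le_rfl)
  have e2 : ∀ z ∈ Ioo a b, ∫⁻ y, K y z ∂μ = w z * ∫⁻ y in Ioo a z, F y := by
    intro z hz
    have : ∀ y, K y z = (Iio z).indicator (fun y => w z * F y) y := fun y => rfl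
    simp_rw [this]
    rw [lintegral_indicator measurableSet_Iio, hμ, Measure.restrict_restrict measurableSet_Iio,
      inter_comm, Ioo_inter_Iio, min_eq_right hz.2.le]
    rw [lintegral_const_mul _ hF]
  rw [← setLIntegral_congr_fun measurableSet_Ioo e1, ← setLIntegral_congr_fun measurableSet_Ioo e2]
  exact lintegral_lintegral_swap hKm

lemma lintegral_Ioo_iterDist [IsFiniteMeasure P] {X : Ω → ℝ} (hX : Measurable X) {a : ℝ}
    (ha : ∀ ω, a ≤ X ω) (k : ℕ) {z : ℝ} (hz : a ≤ z) :
    ∫⁻ y in Ioo a z, ENNReal.ofReal (iterDist (distFun P X) (k + 1) y)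
      = ENNReal.ofReal (iterDist (distFun P X) (k + 2) z) := by
  rw [ofReal_iterDist_succ hX ha, ← Iio_union_Icc_eq_Iic hz,
    lintegral_union (A := Iio a) measurableSet_Icc
    (Set.disjoint_left.2 fun y hy hy' => not_lt.2 hy'.1 hy),
    setLIntegral_congr_fun (s := Iio a) (g := fun _ => 0) measurableSet_Iio
      (fun y hy => by simp only [iterDist_eq_zero hX ha k hy, ENNReal.ofReal_zero])]
  rw [lintegral_zero, zero_add, restrict_Ioo_eq_restrict_Icc]

/-- Integration against a member of the cone respects dominance: each tail integral is moved
onto the iterated distribution function, and the final antitone weight is decomposed into its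
superlevel intervals. -/
theorem IterTail.lintegral_le [IsFiniteMeasure P] {a b : ℝ} (hab : a < b) {X Y : Ω → ℝ}
    (hX : Measurable X) (hXa : ∀ ω, a ≤ X ω) (hY : Measurable Y) (hYa : ∀ ω, a ≤ Y ω)
    {m : ℕ} {w : ℝ → ℝ≥0∞} (hw : IterTail a b m w) (j : ℕ)
    (hdom : ∀ η ∈ Icc a b,
      iterDist (distFun P X) (j + m + 2) η ≤ iterDist (distFun P Y) (j + m + 2) η)
    (hb : ∀ i, j + 2 ≤ i → i ≤ j + m + 2 →
      iterDist (distFun P X) i b ≤ iterDist (distFun P Y) i b) :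
    ∫⁻ x in Ioo a b, w x * ENNReal.ofReal (iterDist (distFun P X) (j + 1) x)
      ≤ ∫⁻ x in Ioo a b, w x * ENNReal.ofReal (iterDist (distFun P Y) (j + 1) x) := by
  have meas : ∀ {Z : Ω → ℝ} (_ : Measurable Z) (_ : ∀ ω, a ≤ Z ω) (k : ℕ),
      Measurable fun x => ENNReal.ofReal (iterDist (distFun P Z) (k + 1) x) := fun hZ hZa k =>
    (iterDist_mono hZ hZa k).measurable.ennreal_ofReal
  induction m generalizing w j with
  | zero =>
    obtain ⟨w₀, h1, h2⟩ := hw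
    set w₁ := (Ioo a b).indicator w₀ with hw₁
    have hw₁0 : ∀ x, 0 ≤ w₁ x := indicator_nonneg fun x hx => (h2 x hx).1
    have hw₁m : Measurable w₁ := by
      refine measurable_of_restrict_of_restrict_compl (s := Ioo a b) measurableSet_Ioo ?_ ?_
      · have : Antitone ((Ioo a b).domRestrict w₁) := fun x y hxy => by
          simp only [domRestrict_apply, hw₁, indicator_of_mem x.2, indicator_of_mem y.2]
          exact h1 x.2 y.2 hxy
        exact this.measurable
      · have : (Ioo a b)ᶜ.domRestrict w₁ = fun _ => 0 := by
          funext x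
          simp only [domRestrict_apply, hw₁, indicator_of_notMem x.2]
        rw [this]; exact measurable_const
    -- superlevel sets are intervals with left end point `a`
    have hsup : ∀ t > 0, (∀ F : ℝ → ℝ≥0∞, ∫⁻ x in {x | t < w₁ x} ∩ Ioo a b, F x = 0) ∨
        ∃ c ∈ Icc a b, ∀ F : ℝ → ℝ≥0∞,
          ∫⁻ x in {x | t < w₁ x} ∩ Ioo a b, F x = ∫⁻ x in Ioo a c, F x := by
      intro t ht
      set S := {x | t < w₁ x} ∩ Ioo a b with hS
      rcases S.eq_empty_or_nonempty with he | hne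
      · left; intro F; simp [he]
      right
      have hbdd : BddAbove S := ⟨b, fun x hx => hx.2.2.le⟩
      have h1' : Ioo a (sSup S) ⊆ S := by
        intro x hx
        obtain ⟨y, hy, hxy⟩ := exists_lt_of_lt_csSup hne hx.2
        have hxI : x ∈ Ioo a b := ⟨hx.1, hxy.trans hy.2.2⟩
        refine ⟨?_, hxI⟩
        have hyt : t < w₁ y := hy.1
        rw [hw₁, indicator_of_mem hy.2] at hyt
        rw [mem_ofPred_eq, hw₁, indicator_of_mem hxI]
        exact hyt.trans_le (h1 hxI hy.2 hxy.le)
      have h2' : S ⊆ Ioc a (sSup S) := fun x hx => ⟨hx.2.1, le_csSup hbdd hx⟩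
      refine ⟨sSup S, ⟨?_, csSup_le hne fun x hx => hx.2.2.le⟩, fun F => ?_⟩
      · obtain ⟨y, hy⟩ := hne
        exact hy.2.1.le.trans (le_csSup hbdd hy)
      · refine setLIntegral_congr ?_
        refine EventuallyLE.antisymm ?_ (LE.le.eventuallyLE h1')
        exact (LE.le.eventuallyLE h2').trans Ioo_ae_eq_Ioc.symm.le
    have key : ∀ {Z : Ω → ℝ} (_ : Measurable Z) (_ : ∀ ω, a ≤ Z ω),
        ∫⁻ x in Ioo a b, w x * ENNReal.ofReal (iterDist (distFun P Z) (j + 1) x)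
          = ∫⁻ t in Ioi (0 : ℝ), ∫⁻ x in {x | t < w₁ x} ∩ Ioo a b,
            ENNReal.ofReal (iterDist (distFun P Z) (j + 1) x) := by
      intro Z hZ hZa
      set F := fun x => ENNReal.ofReal (iterDist (distFun P Z) (j + 1) x) with hF
      have hFm : Measurable F := meas hZ hZa j
      have e1 : ∫⁻ x in Ioo a b, w x * F x
          = ∫⁻ x, ENNReal.ofReal (w₁ x) ∂((volume.restrict (Ioo a b)).withDensity F) := by
        rw [lintegral_withDensity_eq_lintegral_mul _ hFm hw₁m.ennreal_ofReal]
        refine setLIntegral_congr_fun measurableSet_Ioo fun x hx => ?_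
        simp only [Pi.mul_apply, hw₁, indicator_of_mem hx]
        rw [(h2 x hx).2, mul_comm]
      rw [e1, lintegral_eq_lintegral_meas_lt _ (Eventually.of_forall hw₁0) hw₁m.aemeasurable]
      refine lintegral_congr fun t => ?_
      have hms : MeasurableSet {x | t < w₁ x} := measurableSet_lt measurable_const hw₁m
      rw [withDensity_apply _ hms, Measure.restrict_restrict hms]
    rw [key hX hXa, key hY hYa]
    refine setLIntegral_mono' measurableSet_Ioi fun t ht => ?_
    rcases hsup t ht with h0 | ⟨c, hc, hF⟩
    · rw [h0, h0]
    · rw [hF, hF, lintegral_Ioo_iterDist hX hXa _ hc.1, lintegral_Ioo_iterDist hY hYa _ hc.1]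
      exact ENNReal.ofReal_le_ofReal (hdom c hc)
  | succ m ih =>
    obtain ⟨c, w', hw', h2⟩ := hw
    have key : ∀ {Z : Ω → ℝ} (_ : Measurable Z) (_ : ∀ ω, a ≤ Z ω),
        ∫⁻ x in Ioo a b, w x * ENNReal.ofReal (iterDist (distFun P Z) (j + 1) x)
          = c * ENNReal.ofReal (iterDist (distFun P Z) (j + 2) b)
            + ∫⁻ z in Ioo a b, w' z * ENNReal.ofReal (iterDist (distFun P Z) (j + 2) z) := by
      intro Z hZ hZa
      rw [setLIntegral_congr_fun measurableSet_Ioo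
        (g := fun x => c * ENNReal.ofReal (iterDist (distFun P Z) (j + 1) x) +
          (∫⁻ z in Ioo x b, w' z) * ENNReal.ofReal (iterDist (distFun P Z) (j + 1) x))
        (fun x hx => by simp only [h2 x hx, add_mul]),
        lintegral_add_left ((meas hZ hZa j).const_mul c), lintegral_const_mul _ (meas hZ hZa j),
        lintegral_Ioo_iterDist hZ hZa _ hab.le, lintegral_tail_mul hw'.aemeasurable (meas hZ hZa j)]
      congr 1
      exact setLIntegral_congr_fun measurableSet_Ioo fun z hz => by
        simp only [lintegral_Ioo_iterDist hZ hZa _ hz.1.le]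
    rw [key hX hXa, key hY hYa]
    have e : j + 1 + m + 2 = j + (m + 1) + 2 := by omega
    refine add_le_add (mul_le_mul_right (ENNReal.ofReal_le_ofReal
      (hb (j + 2) le_rfl (by omega))) _)
      (ih hw' (j + 1) ?_ fun i h1 h2 => hb i (by omega) (by omega))
    rw [e]; exact hdom

/-! ### Expected utility of an `n`-monotone utility -/

/-- The fundamental theorem of calculus up to the right end point, where `g` need only have a
limit and `w` need not be defined. -/
lemma ofReal_sub_eq_lintegral_tail {a b c : ℝ} {g w : ℝ → ℝ} (hg : ContinuousOn g (Ioo a b))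
    (hd : ∀ y ∈ Ioo a b, HasDerivWithinAt g (-w y) (Ioi y) y) (hw : AntitoneOn w (Ioo a b))
    (hw0 : ∀ y ∈ Ioo a b, 0 ≤ w y) (hc : Tendsto g (𝓝[<] b) (𝓝 c)) {x : ℝ} (hx : x ∈ Ioo a b) :
    ENNReal.ofReal (g x - c) = ∫⁻ z in Ioo x b, ENNReal.ofReal (w z) := by
  set G := Function.update g b c with hG
  set W := Function.update w b 0 with hW
  have hGe : ∀ y, y ≠ b → G y = g y := fun y hy => Function.update_of_ne hy _ _
  have hWe : ∀ y, y ≠ b → W y = w y := fun y hy => Function.update_of_ne hy _ _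
  have hW0 : ∀ y ∈ Icc x b, 0 ≤ W y := by
    intro y hy
    rcases hy.2.lt_or_eq with h | rfl
    · rw [hWe y h.ne]; exact hw0 y ⟨hx.1.trans_le hy.1, h⟩
    · simp [hW]
  have hWanti : AntitoneOn W (Icc x b) := by
    intro y hy z hz hyz
    rcases hz.2.lt_or_eq with h | rfl
    · have hyb := hyz.trans_lt h
      rw [hWe z h.ne, hWe y hyb.ne]
      exact hw ⟨hx.1.trans_le hy.1, hyb⟩ ⟨hx.1.trans_le hz.1, h⟩ hyz
    · have : W z = 0 := by simp [hW]
      rw [this]; exact hW0 y hy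
  have hWi : IntervalIntegrable W volume x b :=
    AntitoneOn.intervalIntegrable (by rwa [uIcc_of_le hx.2.le])
  have hGc : ContinuousOn G (Icc x b) := by
    intro y hy
    rcases hy.2.lt_or_eq with h | rfl
    · have h1 : ContinuousAt g y := hg.continuousAt (Ioo_mem_nhds (hx.1.trans_le hy.1) h)
      refine (h1.congr ?_).continuousWithinAt
      filter_upwards [Iio_mem_nhds h] with z hz using (hGe z (ne_of_lt hz)).symm
    · rw [hG, continuousWithinAt_update_same]
      exact hc.mono_left (nhdsWithin_mono _ fun z hz => lt_of_le_of_ne hz.1.2 hz.2)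
  have hGd : ∀ y ∈ Ioo x b, HasDerivWithinAt G (-W y) (Ioi y) y := by
    intro y hy
    rw [hWe y hy.2.ne]
    refine (hd y ⟨hx.1.trans hy.1, hy.2⟩).congr_of_eventuallyEq ?_ (hGe y hy.2.ne)
    filter_upwards [mem_nhdsWithin_of_mem_nhds (Iio_mem_nhds hy.2)] with z hz
      using hGe z (ne_of_lt hz)
  have hint := intervalIntegral.integral_eq_sub_of_hasDeriv_right_of_le hx.2.le hGc hGd hWi.neg
  have hGb : G b = c := by simp [hG]
  rw [intervalIntegral.integral_neg, hGb, hGe x hx.2.ne] at hint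
  have : g x - c = ∫ y in x..b, W y := by linarith
  rw [this, intervalIntegral.integral_of_le hx.2.le, integral_Ioc_eq_integral_Ioo,
    ofReal_integral_eq_lintegral_ofReal]
  · exact setLIntegral_congr_fun measurableSet_Ioo fun z hz => by simp only [hWe z hz.2.ne]
  · exact ((intervalIntegrable_iff_integrableOn_Ioo_of_le hx.2.le).1 hWi)
  · exact (ae_restrict_iff' measurableSet_Ioo).2
      (Eventually.of_forall fun z hz => hW0 z (Ioo_subset_Icc_self hz))

lemma IterTail.succ_of_hasDeriv {a b : ℝ} {m : ℕ} {g w : ℝ → ℝ}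
    (hab : a < b) (hg : ContinuousOn g (Ioo a b)) (hg0 : ∀ x ∈ Ioo a b, 0 ≤ g x)
    (hga : AntitoneOn g (Ioo a b))
    (hd : ∀ y ∈ Ioo a b, HasDerivWithinAt g (-w y) (Ioi y) y) (hw : AntitoneOn w (Ioo a b))
    (hw0 : ∀ y ∈ Ioo a b, 0 ≤ w y) (hm : IterTail a b m fun x => ENNReal.ofReal (w x)) :
    IterTail a b (m + 1) fun x => ENNReal.ofReal (g x) := by
  have hbd : BddBelow (g '' Ioo a b) := ⟨0, by rintro _ ⟨x, hx, rfl⟩; exact hg0 x hx⟩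
  have hne : (Ioo a b).Nonempty := nonempty_Ioo.2 hab
  have hlim : Tendsto g (𝓝[<] b) (𝓝 (sInf (g '' Ioo a b))) :=
    AntitoneOn.tendsto_nhdsWithin_Ioo_left hne hga hbd
  refine ⟨ENNReal.ofReal (sInf (g '' Ioo a b)), _, hm, fun x hx => ?_⟩
  rw [← ofReal_sub_eq_lintegral_tail hg hd hw hw0 hlim hx, ← ENNReal.ofReal_add]
  · rw [add_sub_cancel]
  · exact le_csInf (hne.image g) (by rintro _ ⟨x, hx, rfl⟩; exact hg0 x hx)
  · exact sub_nonneg.2 (csInf_le hbd (mem_image_of_mem g hx))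

/-- The derivative of an `n`-monotone function is an `(n - 2)`-fold iterated tail integral. -/
lemma IsNMonotone.iterTail {n : ℕ} (hn : 3 ≤ n) {a b : ℝ} (hab : a < b) {f : ℝ → ℝ}
    (hf : IsNMonotone n a b f) :
    (∀ x ∈ Ioo a b, HasDerivAt f (deriv f x) x) ∧ AntitoneOn (deriv f) (Ioo a b) ∧
      (∀ x ∈ Ioo a b, 0 ≤ deriv f x) ∧
      IterTail a b (n - 2) fun x => ENNReal.ofReal (deriv f x) := by
  obtain ⟨-, hf2⟩ := hf
  obtain ⟨-, hk, hanti, hconv⟩ := hf2 (by omega)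
  set G : ℕ → ℝ → ℝ := fun k x => (-1 : ℝ) ^ (k - 1) * iteratedDeriv k f x with hG
  have hGd : ∀ k, 1 ≤ k → k + 1 ≤ n - 2 → ∀ x ∈ Ioo a b, HasDerivAt (G k) (-G (k + 1) x) x := by
    intro k hk1 hk2 x hx
    have h1 := (hk (k + 1) (Finset.mem_Icc.2 ⟨by omega, hk2⟩) x hx).1
    have h2 := h1.hasDerivAt.const_mul ((-1 : ℝ) ^ (k - 1))
    rw [Nat.add_sub_cancel] at h2
    refine h2.congr_deriv ?_
    simp only [hG]
    rw [Nat.add_sub_cancel, iteratedDeriv_succ]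
    obtain ⟨j, rfl⟩ : ∃ j, k = j + 1 := ⟨k - 1, by omega⟩
    simp only [Nat.add_sub_cancel]
    ring
  have hG0 : ∀ k, 1 ≤ k → k ≤ n - 2 → ∀ x ∈ Ioo a b, 0 ≤ G k x := fun k h1 h2 x hx =>
    (hk k (Finset.mem_Icc.2 ⟨h1, h2⟩) x hx).2
  have hGn : (fun x => (-1 : ℝ) ^ (n - 1) * iteratedDeriv (n - 2) f x) = G (n - 2) := by
    funext x
    simp only [hG]
    obtain ⟨m, rfl⟩ : ∃ m, n = m + 3 := ⟨n - 3, by omega⟩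
    have e1 : m + 3 - 1 = m + 2 := by omega
    have e2 : m + 3 - 2 - 1 = m := by omega
    rw [e1, e2]; ring
  rw [hGn] at hanti hconv
  have main : ∀ i, ∀ k, 1 ≤ k → k + i = n - 2 →
      AntitoneOn (G k) (Ioo a b) ∧ IterTail a b (i + 1) fun x => ENNReal.ofReal (G k x) := by
    intro i
    induction i with
    | zero =>
      intro k hk1 hkn
      obtain rfl : k = n - 2 := by omega
      have hint : interior (Ioo a b) = Ioo a b := isOpen_Ioo.interior_eq
      have hrd : ∀ y ∈ Ioo a b,
          HasDerivWithinAt (G (n - 2)) (derivWithin (G (n - 2)) (Ioi y) y) (Ioi y) y :=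
        fun y hy => hconv.hasDerivWithinAt_rightDeriv_of_mem_interior (by rwa [hint])
      refine ⟨hanti, IterTail.succ_of_hasDeriv hab (hconv.continuousOn isOpen_Ioo)
        (hG0 _ hk1 le_rfl) hanti (w := fun y => -derivWithin (G (n - 2)) (Ioi y) y) ?_ ?_ ?_ ?_⟩
      · intro y hy; simpa using hrd y hy
      · have := hconv.monotoneOn_rightDeriv
        rw [hint] at this
        exact this.neg
      · intro y hy
        obtain ⟨z, hyz, hzb⟩ := exists_between hy.2
        have h1 := hconv.rightDeriv_le_slope_of_mem_interior (by rwa [hint])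
          (⟨hy.1.trans hyz, hzb⟩ : z ∈ Ioo a b) hyz
        have h2 : slope (G (n - 2)) y z ≤ 0 := by
          rw [slope_def_field]
          exact div_nonpos_of_nonpos_of_nonneg
            (sub_nonpos.2 (hanti hy ⟨hy.1.trans hyz, hzb⟩ hyz.le)) (sub_nonneg.2 hyz.le)
        linarith
      · refine ⟨_, ?_, fun x hx => ⟨?_, rfl⟩⟩
        · have := hconv.monotoneOn_rightDeriv
          rw [hint] at this
          exact this.neg
        · obtain ⟨z, hyz, hzb⟩ := exists_between hx.2
          have h1 := hconv.rightDeriv_le_slope_of_mem_interior (by rwa [hint])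
            (⟨hx.1.trans hyz, hzb⟩ : z ∈ Ioo a b) hyz
          have h2 : slope (G (n - 2)) x z ≤ 0 := by
            rw [slope_def_field]
            exact div_nonpos_of_nonpos_of_nonneg
              (sub_nonpos.2 (hanti hx ⟨hx.1.trans hyz, hzb⟩ hyz.le)) (sub_nonneg.2 hyz.le)
          linarith
    | succ i ih =>
      intro k hk1 hkn
      obtain ⟨h1, h2⟩ := ih (k + 1) (by omega) (by omega)
      have hd := hGd k hk1 (by omega)
      have hc : ContinuousOn (G k) (Ioo a b) := fun x hx =>
        (hd x hx).continuousAt.continuousWithinAt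
      have hak : AntitoneOn (G k) (Ioo a b) := by
        refine antitoneOn_of_deriv_nonpos (convex_Ioo a b) hc ?_ ?_
        · rw [isOpen_Ioo.interior_eq]
          exact fun x hx => (hd x hx).differentiableAt.differentiableWithinAt
        · rw [isOpen_Ioo.interior_eq]
          intro x hx
          rw [(hd x hx).deriv]
          linarith [hG0 (k + 1) (by omega) (by omega) x hx]
      exact ⟨hak, IterTail.succ_of_hasDeriv hab hc (hG0 k hk1 (by omega)) hak
        (fun y hy => (hd y hy).hasDerivWithinAt) h1 (hG0 (k + 1) (by omega) (by omega)) h2⟩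
  have hG1 : G 1 = deriv f := by funext x; simp [hG, iteratedDeriv_one]
  obtain ⟨m1, m2⟩ := main (n - 3) 1 le_rfl (by omega)
  have en : n - 3 + 1 = n - 2 := by omega
  rw [hG1] at m1 m2
  rw [en] at m2
  refine ⟨fun x hx => ?_, m1, fun x hx => ?_, m2⟩
  · have := (hk 1 (Finset.mem_Icc.2 ⟨le_rfl, by omega⟩) x hx).1
    simpa using this.hasDerivAt
  · have := hG0 1 le_rfl (by omega) x hx
    rwa [hG1] at this

/-- An increasing concave function on `[a, b]` is continuous at `b`. -/
lemma tendsto_right_endpoint {a b : ℝ} (hab : a < b) {f : ℝ → ℝ} (hm : MonotoneOn f (Icc a b))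
    (hc : ConcaveOn ℝ (Icc a b) f) : Tendsto f (𝓝[<] b) (𝓝 (f b)) := by
  have hlow : Tendsto (fun y => ((b - y) / (b - a)) * f a + ((y - a) / (b - a)) * f b)
      (𝓝[<] b) (𝓝 (f b)) := by
    have : ContinuousAt (fun y => ((b - y) / (b - a)) * f a + ((y - a) / (b - a)) * f b) b := by
      fun_prop
    have h2 := this.tendsto
    have e : ((b - b) / (b - a)) * f a + ((b - a) / (b - a)) * f b = f b := by
      rw [div_self (by linarith)]; simp
    rw [e] at h2
    exact h2.mono_left nhdsWithin_le_nhds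
  have hab' : 0 < b - a := by linarith
  refine tendsto_of_tendsto_of_tendsto_of_le_of_le' hlow tendsto_const_nhds ?_ ?_
  · filter_upwards [Ioo_mem_nhdsLT hab] with y hy
    have h1 := hc.2 (left_mem_Icc.2 hab.le) (right_mem_Icc.2 hab.le)
      (div_nonneg (by linarith [hy.2] : 0 ≤ b - y) hab'.le)
      (div_nonneg (by linarith [hy.1] : 0 ≤ y - a) hab'.le) (by field_simp; ring)
    have e : ((b - y) / (b - a)) • a + ((y - a) / (b - a)) • b = y := by
      simp only [smul_eq_mul]; field_simp; ring
    rw [e] at h1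
    simpa using h1
  · filter_upwards [Ioo_mem_nhdsLT hab] with y hy
    exact hm ⟨hy.1.le, hy.2.le⟩ (right_mem_Icc.2 hab.le) hy.2.le

/-- Expected utility of an `n`-monotone utility respects `n`-th order dominance. -/
theorem StochDom.integral_le [IsProbabilityMeasure P] {a b : ℝ} (hab : a < b) {n : ℕ} (hn : 3 ≤ n)
    {u : ℝ → ℝ} (hu : IsNMonotone n a b u) {X Y : RandVar Ω a b} (h : StochDom P n X Y) :
    ∫ ω, u (Y.1 ω) ∂P ≤ ∫ ω, u (X.1 ω) ∂P := by
  obtain ⟨hd, hwa, hw0, hit⟩ := hu.iterTail hn hab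
  have hmono := hu.1
  have hlim := tendsto_right_endpoint hab hmono (hu.2 (by omega)).1
  set w : ℝ → ℝ≥0∞ := fun x => ENNReal.ofReal (deriv u x) with hw
  have tail : ∀ x ∈ Ioo a b, ENNReal.ofReal (u b - u x) = ∫⁻ z in Ioo x b, w z := by
    intro x hx
    have := ofReal_sub_eq_lintegral_tail (g := fun x => u b - u x) (w := deriv u) (c := 0)
      (fun y hy => ((hd y hy).continuousAt.continuousWithinAt).const_sub _)
      (fun y hy => ((hd y hy).const_sub (u b)).hasDerivWithinAt) hwa hw0
      (by simpa using hlim.const_sub (u b)) hx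
    simpa using this
  have tail_a : ∫⁻ z in Ioo a b, w z ≤ ENNReal.ofReal (u b - u a) := by
    obtain ⟨s, hs1, hs2, hs3⟩ := exists_seq_strictAnti_tendsto' hab
    have hU : Ioo a b = ⋃ i, Ioo (s i) b := by
      ext z
      simp only [mem_iUnion, mem_Ioo]
      constructor
      · intro hz
        obtain ⟨i, hi⟩ := (hs3.eventually (gt_mem_nhds hz.1)).exists
        exact ⟨i, hi, hz.2⟩
      · rintro ⟨i, hi, hzb⟩
        exact ⟨(hs2 i).1.trans hi, hzb⟩
    rw [hU, setLIntegral_iUnion_of_directed]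
    · refine iSup_le fun i => ?_
      rw [← tail _ (hs2 i)]
      exact ENNReal.ofReal_le_ofReal (sub_le_sub_left
        (hmono (left_mem_Icc.2 hab.le) ⟨(hs2 i).1.le, (hs2 i).2.le⟩ (hs2 i).1.le) _)
    · refine directed_of_isDirected_le fun i j hij => Ioo_subset_Ioo_left ?_
      exact hs1.antitone hij
  -- `J` is the jump of `u` at `a`, which pairs with the atoms of `X` and `Y` at `a`
  obtain ⟨J, hJ⟩ : ∃ J : ℝ≥0∞, ENNReal.ofReal (u b - u a) = J + ∫⁻ z in Ioo a b, w z :=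
    ⟨_, (tsub_add_cancel_of_le tail_a).symm⟩
  have repr : ∀ x ∈ Icc a b, ENNReal.ofReal (u b - u x)
      = (if x ≤ a then J else 0) + ∫⁻ z in Ioo a b, (Ici x).indicator w z := by
    intro x hx
    rw [lintegral_indicator measurableSet_Ici, Measure.restrict_restrict measurableSet_Ici]
    rcases hx.1.lt_or_eq with h1 | rfl
    · have : Ici x ∩ Ioo a b = Ico x b := by
        ext z; simp only [mem_inter_iff, mem_Ici, mem_Ioo, mem_Ico]
        exact ⟨fun hz => ⟨hz.1, hz.2.2⟩, fun hz => ⟨hz.1, h1.trans_le hz.1, hz.2⟩⟩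
      rw [if_neg (not_le.2 h1), zero_add, this, ← restrict_Ioo_eq_restrict_Ico]
      rcases hx.2.lt_or_eq with h2 | rfl
      · exact tail x ⟨h1, h2⟩
      · simp
    · have : Ici a ∩ Ioo a b = Ioo a b := inter_eq_right.2 fun z hz => hz.1.le
      rw [if_pos le_rfl, this, hJ]
  have expect : ∀ X : RandVar Ω a b, ∫⁻ ω, ENNReal.ofReal (u b - u (X.1 ω)) ∂P
      = J * ENNReal.ofReal (distFun P X.1 a)
        + ∫⁻ z in Ioo a b, w z * ENNReal.ofReal (iterDist (distFun P X.1) (0 + 1) z) := by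
    intro X
    rw [lintegral_congr fun ω => repr _ (X.2.2 ω)]
    have hms : ∀ z, MeasurableSet {ω | X.1 ω ≤ z} := fun z =>
      measurableSet_le X.2.1 measurable_const
    have e1 : ∀ ω, (if X.1 ω ≤ a then J else 0) = {ω | X.1 ω ≤ a}.indicator (fun _ => J) ω :=
      fun ω => rfl
    simp_rw [e1]
    rw [lintegral_add_left (measurable_const.indicator (hms a)), lintegral_indicator (hms a),
      setLIntegral_const, ofReal_distFun]
    congr 1
    rw [lintegral_lintegral_swap]
    · refine lintegral_congr fun z => ?_
      change _ = w z * ENNReal.ofReal (distFun P X.1 z)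
      rw [ofReal_distFun]
      have e2 : ∀ ω, (Ici (X.1 ω)).indicator w z = {ω | X.1 ω ≤ z}.indicator (fun _ => w z) ω :=
        fun ω => rfl
      simp_rw [e2]
      rw [lintegral_indicator (hms z), setLIntegral_const]
    · have hm : MeasurableSet {p : Ω × ℝ | X.1 p.1 ≤ p.2} :=
        measurableSet_le (X.2.1.comp measurable_fst) measurable_snd
      have : AEMeasurable (fun p : Ω × ℝ => w p.2) (P.prod (volume.restrict (Ioo a b))) :=
        hit.aemeasurable.comp_quasiMeasurePreserving Measure.quasiMeasurePreserving_snd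
      exact this.indicator hm
  have hint : ∀ X : RandVar Ω a b, Integrable (fun ω => u (X.1 ω)) P := fun X =>
    Integrable.of_bound (C := max |u a| |u b|)
      (measurable_comp_randVar hmono X).aestronglyMeasurable
      (Eventually.of_forall fun ω =>
        abs_le_max_abs_abs (le_comp_randVar hmono X ω) (comp_randVar_le hmono X ω))
  have key : ∫⁻ ω, ENNReal.ofReal (u b - u (X.1 ω)) ∂P
      ≤ ∫⁻ ω, ENNReal.ofReal (u b - u (Y.1 ω)) ∂P := by
    rw [expect X, expect Y]
    have hYa : P {ω | Y.1 ω < a} = 0 := by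
      have : {ω | Y.1 ω < a} = ∅ := by
        ext ω; simpa using (Y.2.2 ω).1
      simp [this]
    have en : 0 + (n - 2) + 2 = n := by omega
    refine add_le_add (mul_le_mul_right (ENNReal.ofReal_le_ofReal
      (h.distFun_le (by omega) (left_mem_Ico.2 hab) hYa)) _)
      (hit.lintegral_le hab X.2.1 (fun ω => (X.2.2 ω).1) Y.2.1 (fun ω => (Y.2.2 ω).1) 0 ?_ ?_)
    · rw [en]; exact h.1
    · intro i h1 h2
      exact h.2 i (Finset.mem_Icc.2 ⟨by omega, by omega⟩)
  have conv : ∀ X : RandVar Ω a b, ∫⁻ ω, ENNReal.ofReal (u b - u (X.1 ω)) ∂P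
      = ENNReal.ofReal (∫ ω, (u b - u (X.1 ω)) ∂P) := fun X =>
    (ofReal_integral_eq_lintegral_ofReal (f := fun ω => u b - u (X.1 ω))
      ((integrable_const _).sub (hint X))
      (Eventually.of_forall fun ω => sub_nonneg.2 (comp_randVar_le hmono X ω))).symm
  rw [conv, conv, ENNReal.ofReal_le_ofReal_iff (integral_nonneg fun ω =>
      sub_nonneg.2 (comp_randVar_le hmono Y ω)),
    integral_sub (integrable_const _) (hint X), integral_sub (integrable_const _) (hint Y)] at key
  linarith

/-- Both admissible forms of the weighting function give a functional that respects dominance. -/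
theorem rdu_le_of_stochDom [IsProbabilityMeasure P] {a b : ℝ} (hab : a < b) {n : ℕ} (hn : 3 ≤ n)
    {u h : ℝ → ℝ} (hh : IsWeighting h) (hc : CaseOne a b u h ∨ ∃ l, CaseTwo n a b u h l)
    {X Y : RandVar Ω a b} (hXY : StochDom P n X Y) : rdu P u h Y ≤ rdu P u h X := by
  rcases hc with hc | ⟨l, hc⟩
  · rw [rdu_eq_of_monotoneOn hab.le hh hc.1 hc.weighting_eq,
      rdu_eq_of_monotoneOn hab.le hh hc.1 hc.weighting_eq]
    have := hXY.essMin_le (by omega) hc.1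
    linarith
  · rw [rdu_eq_of_monotoneOn hab.le hh hc.2.1.1 hc.weighting_eq,
      rdu_eq_of_monotoneOn hab.le hh hc.2.1.1 hc.weighting_eq]
    have h1 := hXY.essMin_le (by omega) hc.2.1.1
    have h2 := hXY.integral_le hab hn hc.2.1
    have hl0 := hc.1.1.le
    have hl1 : 0 ≤ 1 - l := sub_nonneg.2 hc.1.2
    gcongr

/-! ### Elementary dominance tests -/

/-- The functional `R_{u,h}` is monotone with respect to `n`-th order dominance. -/
def Respects (P : Measure Ω) (a b : ℝ) (n : ℕ) (u h : ℝ → ℝ) : Prop :=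
  ∀ X Y : RandVar Ω a b, StochDom P n X Y → rdu P u h Y ≤ rdu P u h X

lemma Respects.monotoneOn [IsProbabilityMeasure P] {a b : ℝ} {n : ℕ} (hn : 1 ≤ n) {u h : ℝ → ℝ}
    (hh : IsWeighting h) (hR : Respects P a b n u h) : MonotoneOn u (Icc a b) := by
  intro x hx y hy hxy
  let C : ∀ c ∈ Icc a b, RandVar Ω a b := fun c hc => ⟨fun _ => c, measurable_const, fun _ => hc⟩
  have hval : ∀ c (hc : c ∈ Icc a b), rdu P u h (C c hc) = u c := by
    intro c hc
    rw [rdu_eq_integral hh (C c hc) (A := u c) (B := u c) (fun _ => le_rfl) (fun _ => le_rfl)]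
    simp
  rw [← hval x hx, ← hval y hy]
  refine hR _ _ (StochDom.mono (k := 1) le_rfl hn ?_)
  have key : ∀ η, distFun P (C y hy).1 η ≤ distFun P (C x hx).1 η := fun η =>
    measureReal_mono fun ω (hω : y ≤ η) => hxy.trans hω
  refine ⟨fun η _ => key η, fun k hk => ?_⟩
  obtain rfl : k = 1 := by simpa using hk
  exact key b

/-- The inequality between decision weights produced by a dominated pair of finite distributions
on common, increasingly ordered points. -/
theorem Respects.sum_nonneg [IsProbabilityMeasure P] (hP : SupportsUniform P) {a b : ℝ} {n : ℕ}
    {u h : ℝ → ℝ} (hh : IsWeighting h) (hR : Respects P a b n u h) {m : ℕ}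
    (x p q : Fin (m + 1) → ℝ) (hxm : Monotone x) (hx : ∀ i, x i ∈ Icc a b)
    (hp : ∀ i, 0 ≤ p i) (hp1 : ∑ i, p i = 1) (hq : ∀ i, 0 ≤ q i) (hq1 : ∑ i, q i = 1)
    {k : ℕ} (hk : 2 ≤ k) (hkn : k ≤ n)
    (hdom : ∀ η ∈ Icc a b, ∑ i, p i * tpow (k - 1) (η - x i) ≤ ∑ i, q i * tpow (k - 1) (η - x i))
    (hb : ∀ j ∈ Finset.Icc 1 (k - 1),
      ∑ i, p i * tpow j (b - x i) ≤ ∑ i, q i * tpow j (b - x i)) :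
    0 ≤ ∑ i : Fin m, (u (x i.succ) - u (x i.castSucc)) *
      (h (∑ j : Fin (m + 1), if (i : ℕ) < (j : ℕ) then p j else 0) -
        h (∑ j : Fin (m + 1), if (i : ℕ) < (j : ℕ) then q j else 0)) := by
  have hu := hR.monotoneOn (by omega) hh
  obtain ⟨X, Y, Z, W, hXY, hX, hY, hZ, hW, hZr, hWr, -, -⟩ :=
    exists_stochDom hP x hx p q hp hp1 hq hq1 hk hdom hb
  have hv : Monotone fun i => u (x i) := fun i j hij => hu (hx i) (hx j) (hxm hij)
  have h1 := hR X Y (hXY.mono (by omega) hkn)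
  rw [rdu_eq_sum hh X Z hv (fun ω => by rw [hX]) hZ,
    rdu_eq_sum hh Y W hv (fun ω => by rw [hY]) hW] at h1
  simp_rw [hZr, hWr, indicator, mem_Ici, Fin.le_def, Fin.val_succ, Nat.succ_le_iff] at h1
  simp_rw [mul_sub, Finset.sum_sub_distrib]
  linarith

/-- A mean-preserving spread does not raise `R_{u,h}`: probability `p + q` at `x` dominates `q` at
`x - p z` and `p` at `x + q z`. Mass `s` sits at `b`, and the remaining mass at `a`. -/
theorem Respects.spread [IsProbabilityMeasure P] (hP : SupportsUniform P) {a b : ℝ} {n : ℕ}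
    (hn : 2 ≤ n) {u h : ℝ → ℝ} (hh : IsWeighting h) (hR : Respects P a b n u h)
    {s p q x z : ℝ} (hs : 0 ≤ s) (hp : 0 ≤ p) (hq : 0 ≤ q) (hspq : s + p + q ≤ 1) (hz : 0 ≤ z)
    (hxa : a ≤ x - p * z) (hxb : x + q * z ≤ b) :
    (u (x + q * z) - u x) * (h (s + p) - h s)
      ≤ (u x - u (x - p * z)) * (h (s + p + q) - h (s + p)) := by
  have hpz : 0 ≤ p * z := mul_nonneg hp hz
  have hqz : 0 ≤ q * z := mul_nonneg hq hz
  have hconv : ∀ η, (p + q) * max (η - x) 0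
      ≤ q * max (η - (x - p * z)) 0 + p * max (η - (x + q * z)) 0 := by
    intro η
    have e1 := mul_le_mul_of_nonneg_left (le_max_left (η - (x - p * z)) 0) hq
    have e2 := mul_le_mul_of_nonneg_left (le_max_left (η - (x + q * z)) 0) hp
    have e3 := mul_nonneg hq (le_max_right (η - (x - p * z)) 0)
    have e4 := mul_nonneg hp (le_max_right (η - (x + q * z)) 0)
    rcases le_total (η - x) 0 with h0 | h0
    · rw [max_eq_right h0]; linarith
    · rw [max_eq_left h0]; nlinarith
  have hx : ∀ i, ![a, x - p * z, x, x + q * z, b] i ∈ Icc a b := by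
    intro i
    fin_cases i <;> simp <;> first | linarith | (constructor <;> linarith)
  have hdom : ∀ η, ∑ i, ![1 - s - p - q, 0, p + q, 0, s] i *
        tpow 1 (η - ![a, x - p * z, x, x + q * z, b] i)
      ≤ ∑ i, ![1 - s - p - q, q, 0, p, s] i *
        tpow 1 (η - ![a, x - p * z, x, x + q * z, b] i) := by
    intro η
    have := hconv η
    simp only [Fin.sum_univ_succ, tpow_one]
    simp
    linarith
  have key := hR.sum_nonneg hP hh (m := 4) ![a, x - p * z, x, x + q * z, b]
    ![1 - s - p - q, 0, p + q, 0, s] ![1 - s - p - q, q, 0, p, s]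
    (Fin.monotone_iff_le_succ.2 fun i => by fin_cases i <;> simp <;> linarith) hx
    (fun i => by fin_cases i <;> simp <;> linarith)
    (by simp [Fin.sum_univ_succ]; ring)
    (fun i => by fin_cases i <;> simp <;> linarith)
    (by simp [Fin.sum_univ_succ]; ring)
    (k := 2) le_rfl hn (fun η _ => hdom η)
    (fun j hj => by
      obtain rfl : j = 1 := by simpa using hj
      exact hdom b)
  have inner : ∀ f : Fin (4 + 1) → ℝ, ∑ i, f i = f 0 + f 1 + f 2 + f 3 + f 4 := Fin.sum_univ_five
  simp only [Fin.sum_univ_four, inner] at key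
  simp at key
  rw [show q + p + s = s + p + q by ring, show p + q + s = s + p + q by ring,
    show p + s = s + p by ring] at key
  linarith

/-- A third-order test. On top of mass `s` at `b`, mass `2 d` at `a + 2 c + t` is spread by `t` and
mass `2 e` is contracted from `a`, `a + 2 c` to `a + c`. When the variances agree, `e c² = d t²`,
the result dominates to third order, because the contraction takes place at the lower outcomes. -/
theorem Respects.transfer [IsProbabilityMeasure P] (hP : SupportsUniform P) {a b : ℝ} {n : ℕ}
    (hn : 3 ≤ n) {u h : ℝ → ℝ} (hh : IsWeighting h) (hR : Respects P a b n u h)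
    {s d e c t : ℝ} (hs : 0 ≤ s) (hd : 0 ≤ d) (he : 0 ≤ e) (hsum : s + 2 * d + 2 * e ≤ 1)
    (hc : 0 ≤ c) (ht : 0 ≤ t) (hb : a + 2 * c + 2 * t ≤ b) (hvar : e * c ^ 2 = d * t ^ 2) :
    0 ≤ (u (a + c) - u a) * (h (s + 2 * d + 2 * e) - h (s + 2 * d + e))
      + (u (a + 2 * c) - u (a + c)) * (h (s + 2 * d) - h (s + 2 * d + e))
      + (u (a + 2 * c + t) - u (a + 2 * c)) * (h (s + d) - h (s + 2 * d))
      + (u (a + 2 * c + 2 * t) - u (a + 2 * c + t)) * (h (s + d) - h s) := by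
  set y := a + 2 * c with hy
  -- second differences of `v ↦ v₊²` lie between `0` and `2 r²`
  have hlow : ∀ w r : ℝ, 0 ≤ r →
      2 * (max (w - r) 0) ^ 2 ≤ (max w 0) ^ 2 + (max (w - 2 * r) 0) ^ 2 := by
    intro w r hr
    rcases le_total (w - r) 0 with h1 | h1
    · rw [max_eq_right h1]
      nlinarith [sq_nonneg (max w 0), sq_nonneg (max (w - 2 * r) 0)]
    · rw [max_eq_left h1, max_eq_left (by linarith : 0 ≤ w)]
      rcases le_total (w - 2 * r) 0 with h2 | h2
      · rw [max_eq_right h2]; nlinarith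
      · rw [max_eq_left h2]; nlinarith
  have hupp : ∀ w r : ℝ, 0 ≤ r →
      (max w 0) ^ 2 + (max (w - 2 * r) 0) ^ 2 ≤ 2 * (max (w - r) 0) ^ 2 + 2 * r ^ 2 := by
    intro w r hr
    rcases le_total w 0 with h0 | h0
    · rw [max_eq_right h0, max_eq_right (by linarith : w - 2 * r ≤ 0)]
      nlinarith [sq_nonneg (max (w - r) 0), sq_nonneg r]
    rw [max_eq_left h0]
    rcases le_total (w - r) 0 with h1 | h1
    · rw [max_eq_right h1, max_eq_right (by linarith : w - 2 * r ≤ 0)]; nlinarith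
    · rw [max_eq_left h1]
      rcases le_total (w - 2 * r) 0 with h2 | h2
      · rw [max_eq_right h2]; nlinarith
      · rw [max_eq_left h2]; nlinarith
  have hconv : ∀ η, 2 * e * (max (η - (a + c)) 0) ^ 2 + d * (max (η - y) 0) ^ 2
        + d * (max (η - (y + 2 * t)) 0) ^ 2
      ≤ e * (max (η - a) 0) ^ 2 + e * (max (η - y) 0) ^ 2
        + 2 * d * (max (η - (y + t)) 0) ^ 2 := by
    intro η
    have e1 : η - a - c = η - (a + c) := by ring
    have e2 : η - a - 2 * c = η - y := by rw [hy]; ring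
    have e3 : η - y - t = η - (y + t) := by ring
    have e4 : η - y - 2 * t = η - (y + 2 * t) := by ring
    -- below `y` only the contraction matters; above `y` its effect is exactly `2 e c²`, which
    -- covers the effect of the spread
    rcases le_total η y with h0 | h0
    · have h1 := hlow (η - a) c hc
      rw [e1, e2] at h1
      rw [max_eq_right (by linarith : η - y ≤ 0)] at h1 ⊢
      rw [max_eq_right (by linarith : η - (y + t) ≤ 0),
        max_eq_right (by linarith : η - (y + 2 * t) ≤ 0)]
      nlinarith
    · have h1 := hupp (η - y) t ht
      rw [e3, e4] at h1
      have h2 := mul_le_mul_of_nonneg_left h1 hd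
      rw [max_eq_left (by linarith : 0 ≤ η - (a + c)), max_eq_left (by linarith : 0 ≤ η - a)]
      rw [max_eq_left (by linarith : 0 ≤ η - y)] at h2 ⊢
      have e5 : e * (η - a) ^ 2 + e * (η - y) ^ 2 - 2 * e * (η - (a + c)) ^ 2
          = 2 * (e * c ^ 2) := by
        rw [hy]; ring
      rw [hvar] at e5
      linarith
  have hx : ∀ i, ![a, a + c, y, y + t, y + 2 * t, b] i ∈ Icc a b := by
    intro i
    fin_cases i <;> simp <;> first | linarith | (constructor <;> linarith)
  set p := ![1 - s - 2 * d - 2 * e, 2 * e, d, 0, d, s] with hp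
  set q := ![1 - s - 2 * d - 2 * e + e, 0, e, 2 * d, 0, s] with hq
  have hdom2 : ∀ η, ∑ i, p i * tpow 2 (η - ![a, a + c, y, y + t, y + 2 * t, b] i)
      ≤ ∑ i, q i * tpow 2 (η - ![a, a + c, y, y + t, y + 2 * t, b] i) := by
    intro η
    have := hconv η
    simp only [Fin.sum_univ_six, tpow, hp, hq]
    simp
    linarith
  have hdom1 : ∑ i, p i * tpow 1 (b - ![a, a + c, y, y + t, y + 2 * t, b] i)
      ≤ ∑ i, q i * tpow 1 (b - ![a, a + c, y, y + t, y + 2 * t, b] i) := by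
    have : ∀ i, tpow 1 (b - ![a, a + c, y, y + t, y + 2 * t, b] i)
        = b - ![a, a + c, y, y + t, y + 2 * t, b] i := fun i => by
      rw [tpow_one, max_eq_left (by linarith [(hx i).2])]
    simp only [this]
    simp only [Fin.sum_univ_six, hp, hq]
    simp
    rw [hy]
    linarith
  have key := hR.sum_nonneg hP hh (m := 5) ![a, a + c, y, y + t, y + 2 * t, b] p q
    (Fin.monotone_iff_le_succ.2 fun i => by fin_cases i <;> simp <;> linarith) hx
    (fun i => by fin_cases i <;> simp [hp] <;> linarith)
    (by simp [Fin.sum_univ_succ, hp]; ring)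
    (fun i => by fin_cases i <;> simp [hq] <;> linarith)
    (by simp [Fin.sum_univ_succ, hq]; ring)
    (k := 3) (by omega) hn (fun η _ => hdom2 η)
    (fun j hj => by
      rw [Finset.mem_Icc] at hj
      rcases Nat.lt_or_ge j 2 with h1 | h1
      · obtain rfl : j = 1 := by omega
        exact hdom1
      · obtain rfl : j = 2 := by omega
        exact hdom2 b)
  have inner : ∀ f : Fin (5 + 1) → ℝ, ∑ i, f i = f 0 + f 1 + f 2 + f 3 + f 4 + f 5 :=
    Fin.sum_univ_six
  simp only [Fin.sum_univ_five, inner, hp, hq] at key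
  simp at key
  rw [show 2 * e + d + d + s = s + 2 * d + 2 * e by ring,
    show e + 2 * d + s = s + 2 * d + e by ring,
    show d + d + s = s + 2 * d by ring, show 2 * d + s = s + 2 * d by ring,
    show d + s = s + d by ring] at key
  exact key

/-! ### Averaging over a monotone function -/

lemma Monotone.exists_continuousAt {f : ℝ → ℝ} (hf : Monotone f) {x y : ℝ} (hxy : x < y) :
    ∃ c ∈ Ioo x y, ContinuousAt f c := by
  obtain ⟨c, hc, hc'⟩ := (hf.countable_not_continuousAt.dense_compl ℝ).exists_between hxy
  exact ⟨c, hc', not_not.1 hc⟩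

/-- The average of a monotone function over shifted intervals is differentiable in the shift as soon
as the function is continuous at the two end points. -/
lemma hasDerivAt_integral_shift {f : ℝ → ℝ} (hf : Monotone f) {c d : ℝ} (hc : ContinuousAt f c)
    (hd : ContinuousAt f d) (α : ℝ) :
    HasDerivAt (fun ε => ∫ x in c..d, f (x + ε * α)) (α * (f d - f c)) 0 := by
  have hint : ∀ p q, IntervalIntegrable f volume p q := fun p q =>
    (hf.monotoneOn _).intervalIntegrable
  have h1 : ∀ e, ContinuousAt f e →
      HasDerivAt (fun ε : ℝ => ∫ x in c..(e + ε * α), f x) (f e * α) 0 := by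
    intro e he
    have hin : HasDerivAt (fun ε : ℝ => e + ε * α) α 0 := by
      simpa using ((hasDerivAt_id (0 : ℝ)).mul_const α).const_add e
    have hout : HasDerivAt (fun y => ∫ x in c..y, f x) (f (e + 0 * α)) (e + 0 * α) := by
      rw [zero_mul, add_zero]
      exact intervalIntegral.integral_hasDerivAt_right (hint _ _)
        hf.measurable.stronglyMeasurable.stronglyMeasurableAtFilter he
    have := hout.comp (0 : ℝ) hin
    simpa [Function.comp_def] using this
  have h2 := (h1 d hd).sub (h1 c hc)
  refine (h2.congr_of_eventuallyEq (Eventually.of_forall fun ε => ?_)).congr_deriv (by ring)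
  simp only [Pi.sub_apply]
  rw [intervalIntegral.integral_comp_add_right, intervalIntegral.integral_interval_sub_left
    (hint _ _) (hint _ _)]

/-- An inequality between increments of a nonconstant monotone function that holds at every point
and for all small scales forces the inequality between their lengths. -/
lemma mul_le_mul_of_increments {f : ℝ → ℝ} (hf : Monotone f) {c d : ℝ} (hcd : c ≤ d)
    (hc : ContinuousAt f c) (hd : ContinuousAt f d) (hlt : f c < f d) {A B α β γ δ : ℝ}
    (H : ∀ᶠ ε in 𝓝[>] (0 : ℝ), ∀ x ∈ Icc c d,
      (f (x + ε * α) - f (x + ε * β)) * A ≤ (f (x + ε * γ) - f (x + ε * δ)) * B) :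
    (α - β) * A ≤ (γ - δ) * B := by
  -- integrate over `[c, d]` and differentiate at `ε = 0`, where both sides vanish
  set φ : ℝ → ℝ → ℝ := fun α ε => ∫ x in c..d, f (x + ε * α) with hφ
  have hφd : ∀ α, HasDerivAt (φ α) (α * (f d - f c)) 0 := hasDerivAt_integral_shift hf hc hd
  have hmono : ∀ ε α, Monotone fun x => f (x + ε * α) := fun ε α x y hxy =>
    hf (by linarith)
  have hint : ∀ ε α, IntervalIntegrable (fun x => f (x + ε * α)) volume c d := fun ε α =>
    ((hmono ε α).monotoneOn _).intervalIntegrable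
  set Φ : ℝ → ℝ := fun ε => (φ γ ε - φ δ ε) * B - (φ α ε - φ β ε) * A with hΦ
  have hΦd : HasDerivAt Φ (((γ - δ) * B - (α - β) * A) * (f d - f c)) 0 :=
    ((((hφd γ).sub (hφd δ)).mul_const B).sub (((hφd α).sub (hφd β)).mul_const A)).congr_deriv
      (by ring)
  have hΦ0 : Φ 0 = 0 := by simp [hΦ, hφ]
  have hΦpos : ∀ᶠ ε in 𝓝[>] (0 : ℝ), 0 ≤ Φ ε := by
    filter_upwards [H] with ε hε
    have e1 : (φ α ε - φ β ε) * A = ∫ x in c..d, (f (x + ε * α) - f (x + ε * β)) * A := by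
      rw [intervalIntegral.integral_mul_const, intervalIntegral.integral_sub (hint _ _) (hint _ _)]
    have e2 : (φ γ ε - φ δ ε) * B = ∫ x in c..d, (f (x + ε * γ) - f (x + ε * δ)) * B := by
      rw [intervalIntegral.integral_mul_const, intervalIntegral.integral_sub (hint _ _) (hint _ _)]
    simp only [hΦ]
    rw [e1, e2, sub_nonneg]
    exact intervalIntegral.integral_mono_on hcd (((hint _ _).sub (hint _ _)).mul_const _)
      (((hint _ _).sub (hint _ _)).mul_const _) hε
  have hlim := hΦd.tendsto_slope_zero_right
  have hnn : 0 ≤ ((γ - δ) * B - (α - β) * A) * (f d - f c) := by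
    refine ge_of_tendsto hlim ?_
    filter_upwards [hΦpos, self_mem_nhdsWithin] with ε h1 h2
    rw [zero_add, hΦ0, sub_zero, smul_eq_mul]
    exact mul_nonneg (inv_nonneg.2 (le_of_lt h2)) h1
  have := nonneg_of_mul_nonneg_left hnn (sub_pos.2 hlt)
  linarith

/-! ### The shape of the weighting function -/

lemma exists_monotone_eqOn {a b : ℝ} (hab : a ≤ b) {u : ℝ → ℝ} (hu : MonotoneOn u (Icc a b)) :
    ∃ f : ℝ → ℝ, Monotone f ∧ EqOn f u (Icc a b) :=
  ⟨IccExtend hab fun x : Icc a b => u x,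
    Monotone.IccExtend (f := fun x : Icc a b => u x) hab fun x y h => hu x.2 y.2 h,
    fun _ hx => IccExtend_of_mem hab (fun x : Icc a b => u x) hx⟩

/-- Averaging the spread inequality over the location of the spread: the weighting function is
convex unless `u` is constant in the interior. -/
lemma Respects.convexOn_weighting [IsProbabilityMeasure P] (hP : SupportsUniform P) {a b : ℝ}
    (hab : a < b) {n : ℕ} (hn : 2 ≤ n) {u h : ℝ → ℝ} (hh : IsWeighting h)
    (hR : Respects P a b n u h) {x y : ℝ} (hx : x ∈ Ioo a b) (hy : y ∈ Ioo a b)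
    (hxy : u x < u y) : ConvexOn ℝ (Icc 0 1) h := by
  have hu := hR.monotoneOn (by omega) hh
  obtain ⟨f, hf, hfu⟩ := exists_monotone_eqOn hab.le hu
  obtain ⟨c, hc, hfc⟩ := Monotone.exists_continuousAt hf hx.1
  obtain ⟨d, hd, hfd⟩ := Monotone.exists_continuousAt hf hy.2
  have hxlty : x < y := by
    by_contra hle
    exact absurd (hu ⟨hy.1.le, hy.2.le⟩ ⟨hx.1.le, hx.2.le⟩ (not_lt.1 hle)) (not_le.2 hxy)
  have hcd : c < d := hc.2.trans (hxlty.trans hd.1)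
  have hlt : f c < f d := by
    rw [hfu ⟨hc.1.le, (hc.2.trans hx.2).le⟩, hfu ⟨(hy.1.trans hd.1).le, hd.2.le⟩]
    exact (hu ⟨hc.1.le, (hc.2.trans hx.2).le⟩ ⟨hx.1.le, hx.2.le⟩ hc.2.le).trans_lt
      (hxy.trans_le (hu ⟨hy.1.le, hy.2.le⟩ ⟨(hy.1.trans hd.1).le, hd.2.le⟩ hd.1.le))
  refine convexOn_of_slope_mono_adjacent (convex_Icc 0 1) fun {s r t} hs ht hsr hrt => ?_
  have hp : 0 < r - s := sub_pos.2 hsr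
  have hq : 0 < t - r := sub_pos.2 hrt
  have key := mul_le_mul_of_increments hf hcd.le hfc hfd hlt (A := h r - h s) (B := h t - h r)
    (α := t - r) (β := 0) (γ := 0) (δ := -(r - s)) (by
      have t1 : ∀ᶠ ε in 𝓝[>] (0 : ℝ), ε * (r - s) < c - a := by
        have : Tendsto (fun ε : ℝ => ε * (r - s)) (𝓝[>] 0) (𝓝 (0 * (r - s))) :=
          (tendsto_id.mul_const _).mono_left nhdsWithin_le_nhds
        rw [zero_mul] at this
        exact this.eventually (gt_mem_nhds (sub_pos.2 hc.1))
      have t2 : ∀ᶠ ε in 𝓝[>] (0 : ℝ), ε * (t - r) < b - d := by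
        have : Tendsto (fun ε : ℝ => ε * (t - r)) (𝓝[>] 0) (𝓝 (0 * (t - r))) :=
          (tendsto_id.mul_const _).mono_left nhdsWithin_le_nhds
        rw [zero_mul] at this
        exact this.eventually (gt_mem_nhds (sub_pos.2 hd.2))
      filter_upwards [t1, t2, self_mem_nhdsWithin] with ε h1 h2 (h3 : 0 < ε) z hz
      have m1 := mul_pos h3 hp
      have m2 := mul_pos h3 hq
      have k := hR.spread hP hn hh (s := s) (p := r - s) (q := t - r) (x := z) (z := ε) hs.1 hp.le
        hq.le (by linarith [ht.2]) h3.le (by nlinarith [hz.1]) (by nlinarith [hz.2])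
      rw [show s + (r - s) = r by ring, show r + (t - r) = t by ring, mul_comm (t - r) ε,
        mul_comm (r - s) ε] at k
      have e1 : f (z + ε * (t - r)) = u (z + ε * (t - r)) :=
        hfu ⟨by linarith [hz.1, hc.1], by linarith [hz.2]⟩
      have e2 : f z = u z := hfu ⟨by linarith [hz.1, hc.1], by linarith [hz.2, hd.2]⟩
      have e3 : f (z + ε * -(r - s)) = u (z - ε * (r - s)) := by
        rw [show z + ε * -(r - s) = z - ε * (r - s) by ring]
        exact hfu ⟨by linarith [hz.1], by linarith [hz.2, hd.2]⟩
      rw [mul_zero, add_zero, e1, e2, e3]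
      exact k)
  rw [div_le_div_iff₀ hp hq]
  linarith

/-- Averaging the spread inequality over the rank of the spread: the utility is concave unless the
weighting function vanishes on `[0, 1)`. -/
lemma Respects.concaveOn_utility [IsProbabilityMeasure P] (hP : SupportsUniform P) {a b : ℝ}
    {n : ℕ} (hn : 2 ≤ n) {u h : ℝ → ℝ} (hh : IsWeighting h)
    (hR : Respects P a b n u h) (hconv : ConvexOn ℝ (Icc 0 1) h) {r : ℝ} (hr : r ∈ Ico (0 : ℝ) 1)
    (hhr : 0 < h r) : ConcaveOn ℝ (Icc a b) u := by
  have hr0 : 0 < r := by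
    rcases hr.1.lt_or_eq with h1 | h1
    · exact h1
    · rw [← h1, hh.zero] at hhr; exact absurd hhr (lt_irrefl _)
  have hr2 : h (r / 2) < h r := by
    have := hconv.2 (left_mem_Icc.2 zero_le_one) ⟨hr.1, hr.2.le⟩ (by norm_num : (0 : ℝ) ≤ 1 / 2)
      (by norm_num : (0 : ℝ) ≤ 1 / 2) (by norm_num)
    simp only [smul_eq_mul, hh.zero, mul_zero, zero_add] at this
    rw [show 1 / 2 * r = r / 2 by ring] at this
    linarith
  obtain ⟨f, hf, hfh⟩ := exists_monotone_eqOn zero_le_one hh.mono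
  obtain ⟨c, hc, hfc⟩ := Monotone.exists_continuousAt hf (show 0 < r / 2 by linarith)
  obtain ⟨d, hd, hfd⟩ := Monotone.exists_continuousAt hf hr.2
  have hcI : c ∈ Icc (0 : ℝ) 1 := ⟨hc.1.le, by linarith [hc.2, hr.2]⟩
  have hdI : d ∈ Icc (0 : ℝ) 1 := ⟨by linarith [hd.1], hd.2.le⟩
  have hcd : c < d := by linarith [hc.2, hd.1]
  have hlt : f c < f d := by
    rw [hfh hcI, hfh hdI]
    exact (hh.mono hcI ⟨by linarith, by linarith [hr.2]⟩ hc.2.le).trans_lt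
      (hr2.trans_le (hh.mono ⟨hr.1, hr.2.le⟩ hdI hd.1.le))
  refine concaveOn_of_slope_anti_adjacent (convex_Icc a b) fun {x y z} hx hz hxy hyz => ?_
  have hp : 0 < y - x := sub_pos.2 hxy
  have hq : 0 < z - y := sub_pos.2 hyz
  have key := mul_le_mul_of_increments hf hcd.le hfc hfd hlt (A := u z - u y) (B := u y - u x)
    (α := y - x) (β := 0) (γ := z - x) (δ := y - x) (by
      have t1 : ∀ᶠ ε in 𝓝[>] (0 : ℝ), ε * (z - x) < 1 - d := by
        have : Tendsto (fun ε : ℝ => ε * (z - x)) (𝓝[>] 0) (𝓝 (0 * (z - x))) :=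
          (tendsto_id.mul_const _).mono_left nhdsWithin_le_nhds
        rw [zero_mul] at this
        exact this.eventually (gt_mem_nhds (sub_pos.2 hd.2))
      filter_upwards [t1, self_mem_nhdsWithin] with ε h1 (h3 : 0 < ε) s hs
      have m1 := mul_pos h3 hp
      have m2 := mul_pos h3 hq
      have e4 : ε * (z - x) = ε * (y - x) + ε * (z - y) := by ring
      have e5 : ε * (y - x) * ε⁻¹ = y - x := by field_simp
      have e6 : ε * (z - y) * ε⁻¹ = z - y := by field_simp
      have k := hR.spread hP hn hh (s := s) (p := ε * (y - x)) (q := ε * (z - y)) (x := y)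
        (z := ε⁻¹) (by linarith [hs.1, hc.1]) m1.le m2.le (by linarith [hs.2])
        (inv_nonneg.2 h3.le) (by rw [e5]; linarith [hx.1]) (by rw [e6]; linarith [hz.2])
      rw [e5, e6, show y + (z - y) = z by ring, show y - (y - x) = x by ring, add_assoc, ← e4] at k
      have hs0 : 0 ≤ s := by linarith [hs.1, hc.1]
      have i1 : f (s + ε * (y - x)) = h (s + ε * (y - x)) :=
        hfh ⟨by linarith, by linarith [hs.2]⟩
      have i2 : f (s + ε * (z - x)) = h (s + ε * (z - x)) :=
        hfh ⟨by linarith, by linarith [hs.2]⟩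
      have i3 : f s = h s := hfh ⟨by linarith, by linarith [hs.2, hd.2]⟩
      rw [mul_zero, add_zero, i1, i2, i3]
      linarith)
  rw [div_le_div_iff₀ hq hp]
  linarith

/-- If `u` is constant inside `(a, b)` and jumps at `b`, spreads reaching `b` force the weighting
function to vanish. -/
lemma Respects.weighting_eq_zero [IsProbabilityMeasure P] (hP : SupportsUniform P) {a b : ℝ}
    (hab : a < b) {n : ℕ} (hn : 2 ≤ n) {u h : ℝ → ℝ} (hh : IsWeighting h)
    (hR : Respects P a b n u h) {k : ℝ} (hk : ∀ x ∈ Ioo a b, u x = k) (hkb : k < u b) {s : ℝ}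
    (hs : s ∈ Ico (0 : ℝ) 1) : h s = 0 := by
  rcases hs.1.lt_or_eq with h0 | rfl
  · obtain ⟨z, hz⟩ : ∃ z : ℝ, z = (b - a) / 2 := ⟨_, rfl⟩
    have hz0 : 0 < z := by rw [hz]; linarith
    have hs1 : 0 < 1 - s := sub_pos.2 hs.2
    have m1 := mul_pos h0 hz0
    have m2 := mul_pos hs1 hz0
    have e1 : s * z + (1 - s) * z = z := by ring
    have key := hR.spread hP hn hh (s := 0) (p := s) (q := 1 - s) (x := b - (1 - s) * z) (z := z)
      le_rfl h0.le hs1.le (by linarith) hz0.le (by linarith) (by linarith)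
    rw [hk (b - (1 - s) * z) ⟨by linarith, by linarith⟩,
      hk (b - (1 - s) * z - s * z) ⟨by linarith, by linarith⟩, sub_self, zero_mul,
      sub_add_cancel, zero_add, hh.zero, sub_zero] at key
    refine le_antisymm ?_ (hh.mapsTo ⟨hs.1, hs.2.le⟩).1
    exact nonpos_of_mul_nonpos_right key (sub_pos.2 hkb)
  · exact hh.zero

/-- If `h` were strictly convex at the midpoint `s + d`, a spread of the mass at decumulative
probabilities between `s` and `s + 2 d` would cost an amount of first order in its size, whereas the
contraction of equal variance at lower outcomes gains only an amount of second order. -/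
lemma Respects.weighting_midpoint [IsProbabilityMeasure P] (hP : SupportsUniform P) {a b : ℝ}
    {n : ℕ} (hn : 3 ≤ n) {u h : ℝ → ℝ} (hh : IsWeighting h)
    (hR : Respects P a b n u h) (hconv : ConvexOn ℝ (Icc 0 1) h) (hconc : ConcaveOn ℝ (Icc a b) u)
    {c₀ y₀ : ℝ} (hc₀ : a < c₀) (hcy : c₀ < y₀) (hy₀ : y₀ ≤ b) (hlt : u c₀ < u y₀) {s d : ℝ}
    (hs : 0 ≤ s) (hd : 0 < d) (hsd : s + 2 * d < 1) :
    h (s + 2 * d) - h (s + d) ≤ h (s + d) - h s := by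
  by_contra hcon
  rw [not_le] at hcon
  have hu := hR.monotoneOn (by omega) hh
  set κ := (h (s + 2 * d) - h (s + d)) - (h (s + d) - h s) with hκ
  have hκ0 : 0 < κ := sub_pos.2 hcon
  -- by concavity, `u` has slope at least `m` to the left of `c₀`, where all outcomes will lie
  set m := (u y₀ - u c₀) / (y₀ - c₀) with hm
  have hm0 : 0 < m := div_pos (sub_pos.2 hlt) (sub_pos.2 hcy)
  set c := (c₀ - a) / 4 with hc
  have hc0 : 0 < c := by rw [hc]; linarith
  -- the margin `ρ` keeps the ranks away from `1`, where `h` may jump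
  set ρ := (1 - (s + 2 * d)) / 2 with hρ
  have hρ0 : 0 < ρ := by rw [hρ]; linarith
  set D := u b - u a with hD
  have tend : ∀ K : ℝ, Tendsto (fun t : ℝ => K * t) (𝓝[>] 0) (𝓝 0) := by
    intro K
    have : Tendsto (fun t : ℝ => K * t) (𝓝[>] 0) (𝓝 (K * 0)) :=
      (tendsto_id.const_mul K).mono_left nhdsWithin_le_nhds
    rwa [mul_zero] at this
  have t1 : ∀ᶠ t in 𝓝[>] (0 : ℝ), (D * d / (c ^ 2 * ρ)) * t < m * κ :=
    (tend _).eventually (gt_mem_nhds (mul_pos hm0 hκ0))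
  have t2 : ∀ᶠ t in 𝓝[>] (0 : ℝ), (2 * d / c) * t < ρ := (tend _).eventually (gt_mem_nhds hρ0)
  have t3 : ∀ᶠ t in 𝓝[>] (0 : ℝ), 1 * t < c := (tend _).eventually (gt_mem_nhds hc0)
  have t4 : ∀ᶠ t in 𝓝[>] (0 : ℝ), 0 < t := self_mem_nhdsWithin
  obtain ⟨t, h1, h2, h3, ht⟩ := (t1.and (t2.and (t3.and t4))).exists
  rw [one_mul] at h3
  -- the mass `2 e` of the contraction is fixed by equality of the variances
  set e := d * t ^ 2 / c ^ 2 with he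
  have he0 : 0 < e := by positivity
  have heρ : 2 * e ≤ ρ := by
    have : 2 * e = (2 * d / c) * t * (t / c) := by rw [he]; field_simp
    rw [this]
    have h4 : t / c ≤ 1 := (div_le_one hc0).2 h3.le
    have h5 : 0 ≤ 2 * d / c * t := by positivity
    nlinarith
  have hS : s + 2 * d = 1 - 2 * ρ := by rw [hρ]; ring
  have hca : c₀ = a + 4 * c := by rw [hc]; ring
  have key := hR.transfer hP hn hh (s := s) (d := d) (e := e) (c := c) (t := t) hs hd.le he0.le
    (by linarith) hc0.le ht.le (by linarith) (by rw [he]; field_simp)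
  set S := s + 2 * d with hSd
  have hSI : S ∈ Icc (0 : ℝ) 1 := ⟨by rw [hSd]; linarith, by linarith⟩
  have hab : a ≤ b := by linarith
  have I : ∀ r, a ≤ r → r ≤ b → r ∈ Icc a b := fun r h h' => ⟨h, h'⟩
  -- Lipschitz bound for `h` away from `1`
  have hlip : h (S + 2 * e) - h (S + e) ≤ e / ρ := by
    have h6 := hconv.slope_mono_adjacent (x := S + e) (y := S + 2 * e) (z := 1)
      ⟨by linarith [hSI.1], by linarith⟩ ⟨zero_le_one, le_rfl⟩ (by linarith) (by linarith)
    have h7 : (h 1 - h (S + 2 * e)) / (1 - (S + 2 * e)) ≤ 1 / ρ := by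
      have h8 := (hh.mapsTo (⟨by linarith [hSI.1], by linarith⟩ : S + 2 * e ∈ Icc (0 : ℝ) 1)).1
      rw [hh.one]
      exact div_le_div₀ zero_le_one (by linarith) hρ0 (by linarith)
    have h9 := h6.trans h7
    rw [show S + 2 * e - (S + e) = e by ring, div_le_iff₀ he0] at h9
    calc _ ≤ 1 / ρ * e := h9
      _ = e / ρ := by ring
  have b1 : (u (a + c) - u a) * (h (S + 2 * e) - h (S + e)) ≤ D * (e / ρ) := by
    have g1 : 0 ≤ u (a + c) - u a := sub_nonneg.2 (hu (I _ le_rfl hab) (I _ (by linarith)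
      (by linarith)) (by linarith))
    have g2 : u (a + c) - u a ≤ D := sub_le_sub_right (hu (I _ (by linarith) (by linarith))
      (I _ hab le_rfl) (by linarith)) _
    have g3 : 0 ≤ e / ρ := by positivity
    exact (mul_le_mul_of_nonneg_left hlip g1).trans (mul_le_mul_of_nonneg_right g2 g3)
  have b2 : (u (a + 2 * c) - u (a + c)) * (h S - h (S + e)) ≤ 0 := by
    refine mul_nonpos_of_nonneg_of_nonpos (sub_nonneg.2 (hu (I _ (by linarith) (by linarith))
      (I _ (by linarith) (by linarith)) (by linarith))) (sub_nonpos.2 (hh.mono hSI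
        ⟨by linarith [hSI.1], by linarith⟩ (by linarith)))
  set y := a + 2 * c with hy
  have b3 : u (y + 2 * t) - u (y + t) ≤ u (y + t) - u y := by
    have := hconc.slope_anti_adjacent (x := y) (y := y + t) (z := y + 2 * t)
      (I _ (by linarith) (by linarith)) (I _ (by linarith) (by linarith)) (by linarith)
      (by linarith)
    rw [show y + 2 * t - (y + t) = t by ring, show y + t - y = t by ring] at this
    exact (div_le_div_iff_of_pos_right ht).1 this
  have b4 : m * t ≤ u (y + t) - u y := by
    have g1 := hconc.slope_anti_adjacent (x := y) (y := y + t) (z := c₀)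
      (I _ (by linarith) (by linarith)) (I _ (by linarith) (by linarith)) (by linarith)
      (by linarith)
    have g2 := hconc.slope_anti_adjacent (x := y + t) (y := c₀) (z := y₀)
      (I _ (by linarith) (by linarith)) (I _ (by linarith) (by linarith)) (by linarith)
      (by linarith)
    have g3 := g2.trans g1
    rw [show y + t - y = t by ring, le_div_iff₀ ht] at g3
    exact g3
  have hh1 : 0 ≤ h (s + d) - h s := sub_nonneg.2 (hh.mono ⟨hs, by linarith⟩
    ⟨by linarith, by linarith⟩ (by linarith))
  have b5 : (u (y + 2 * t) - u (y + t)) * (h (s + d) - h s)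
      ≤ (u (y + t) - u y) * (h (s + d) - h s) := mul_le_mul_of_nonneg_right b3 hh1
  have b6 : m * t * κ ≤ (u (y + t) - u y) * κ := mul_le_mul_of_nonneg_right b4 hκ0.le
  have b7 : m * t * κ ≤ D * (e / ρ) := by
    have : (u (y + t) - u y) * κ = (u (y + t) - u y) * (h S - h (s + d))
        - (u (y + t) - u y) * (h (s + d) - h s) := by rw [hκ]; ring
    have T3 : (u (y + t) - u y) * (h (s + d) - h S)
        = -((u (y + t) - u y) * (h S - h (s + d))) := by ring
    rw [T3] at key
    linarith only [key, b1, b2, b5, b6, this]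
  have b8 : D * (e / ρ) = (D * d / (c ^ 2 * ρ)) * t * t := by
    rw [he]; field_simp
  rw [b8] at b7
  have b9 := mul_lt_mul_of_pos_right h1 ht
  linarith

/-- A convex weighting function that is affine at midpoints is linear on `[0, 1)`. -/
lemma IsWeighting.linear_of_midpoint {h : ℝ → ℝ} (hh : IsWeighting h)
    (hconv : ConvexOn ℝ (Icc 0 1) h)
    (hmid : ∀ r ∈ Ico (0 : ℝ) 1, h r ≤ 2 * h (r / 2)) :
    ∃ l ∈ Icc (0 : ℝ) 1, ∀ s ∈ Ico (0 : ℝ) 1, h s = l * s := by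
  have hratio : ∀ r ∈ Icc (0 : ℝ) 1, ∀ θ ∈ Icc (0 : ℝ) 1, h (θ * r) ≤ θ * h r := by
    intro r hr θ hθ
    have := hconv.2 (left_mem_Icc.2 zero_le_one) hr (sub_nonneg.2 hθ.2) hθ.1 (by ring)
    simpa [hh.zero] using this
  have hpow : ∀ r ∈ Ico (0 : ℝ) 1, ∀ k : ℕ, h r ≤ 2 ^ k * h (r / 2 ^ k) := by
    intro r hr k
    induction k with
    | zero => simp
    | succ k ih =>
      have hk : r / 2 ^ k ∈ Ico (0 : ℝ) 1 :=
        ⟨div_nonneg hr.1 (by positivity),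
          (div_le_self hr.1 (one_le_pow₀ (by norm_num))).trans_lt hr.2⟩
      have h1 := hmid _ hk
      rw [div_div, ← pow_succ] at h1
      calc h r ≤ 2 ^ k * h (r / 2 ^ k) := ih
        _ ≤ 2 ^ k * (2 * h (r / 2 ^ (k + 1))) := by gcongr
        _ = 2 ^ (k + 1) * h (r / 2 ^ (k + 1)) := by ring
  -- `h(r) / r` increases by convexity, and it takes equal values along `r / 2 ^ k`
  have hprop : ∀ r ∈ Ioo (0 : ℝ) 1, ∀ s ∈ Ioc (0 : ℝ) r, r * h s = s * h r := by
    intro r hr s hs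
    have hrI : r ∈ Icc (0 : ℝ) 1 := ⟨hr.1.le, hr.2.le⟩
    apply le_antisymm
    · have := hratio r hrI (s / r) ⟨div_nonneg hs.1.le hr.1.le, (div_le_one hr.1).2 hs.2⟩
      rw [div_mul_cancel₀ _ hr.1.ne'] at this
      calc r * h s ≤ r * (s / r * h r) := by gcongr; exact hr.1.le
        _ = s * h r := by field_simp [hr.1.ne']
    · -- compare with a dyadic fraction `r / 2 ^ k ≤ s`
      obtain ⟨k, hk⟩ := pow_unbounded_of_one_lt (r / s) (by norm_num : (1 : ℝ) < 2)
      have h2k : (0 : ℝ) < 2 ^ k := by positivity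
      have hk' : r / 2 ^ k ≤ s := by
        rw [div_lt_iff₀ hs.1] at hk
        rw [div_le_iff₀ h2k]; linarith
      have h1 := hratio s ⟨hs.1.le, hs.2.trans hr.2.le⟩ (r / 2 ^ k / s)
        ⟨by have := hr.1; have := hs.1; positivity, (div_le_one hs.1).2 hk'⟩
      rw [div_mul_cancel₀ _ hs.1.ne'] at h1
      have h2 := hpow r ⟨hr.1.le, hr.2⟩ k
      calc s * h r ≤ s * (2 ^ k * h (r / 2 ^ k)) := by gcongr; exact hs.1.le
        _ ≤ s * (2 ^ k * (r / 2 ^ k / s * h s)) := by gcongr; exact hs.1.le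
        _ = r * h s := by have := hs.1.ne'; field_simp
  have hlin : ∀ s ∈ Ico (0 : ℝ) 1, h s = 2 * h (1 / 2) * s := by
    intro s hs
    rcases hs.1.lt_or_eq with h0 | rfl
    · rcases le_total s (1 / 2) with h1 | h1
      · have := hprop (1 / 2) ⟨by norm_num, by norm_num⟩ s ⟨h0, h1⟩
        linarith
      · have := hprop s ⟨h0, hs.2⟩ (1 / 2) ⟨by norm_num, h1⟩
        linarith
    · rw [hh.zero, mul_zero]
  refine ⟨2 * h (1 / 2), ⟨?_, ?_⟩, hlin⟩
  · have := (hh.mapsTo (⟨by norm_num, by norm_num⟩ : (1 / 2 : ℝ) ∈ Icc (0 : ℝ) 1)).1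
    linarith
  · by_contra hcon
    rw [not_le] at hcon
    set l := 2 * h (1 / 2) with hl
    have hl1 : 1 / l < 1 := by rw [div_lt_one (by linarith)]; exact hcon
    have hl0 : 0 < 1 / l := by positivity
    have h1 := hlin ((1 / l + 1) / 2) ⟨by linarith, by linarith⟩
    have h2 := (hh.mapsTo (⟨by linarith, by linarith⟩ : (1 / l + 1) / 2 ∈ Icc (0 : ℝ) 1)).2
    have h3 : l * ((1 / l + 1) / 2) = (1 + l) / 2 := by field_simp
    rw [h1, h3] at h2
    linarith

/-- Monotonicity with respect to third- or higher-order dominance leaves two possibilities for the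
weighting function. -/
theorem Respects.dichotomy [IsProbabilityMeasure P] (hP : SupportsUniform P) {a b : ℝ}
    (hab : a < b) {n : ℕ} (hn : 3 ≤ n) {u h : ℝ → ℝ}
    (hu : ∃ x ∈ Ioc a b, ∃ y ∈ Ioc a b, u x ≠ u y) (hh : IsWeighting h)
    (hR : Respects P a b n u h) :
    (∀ s ∈ Ico (0 : ℝ) 1, h s = 0) ∨
      (ConcaveOn ℝ (Icc a b) u ∧ ∃ l ∈ Ioc (0 : ℝ) 1, ∀ s ∈ Ico (0 : ℝ) 1, h s = l * s) := by
  have hmono := hR.monotoneOn (by omega) hh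
  by_cases hz : ∀ s ∈ Ico (0 : ℝ) 1, h s = 0
  · exact Or.inl hz
  right
  push Not at hz
  obtain ⟨r, hr, hr0⟩ := hz
  have hrpos : 0 < h r := lt_of_le_of_ne (hh.mapsTo ⟨hr.1, hr.2.le⟩).1 (Ne.symm hr0)
  obtain ⟨x, hx, y, hy, hxy⟩ : ∃ x ∈ Ioo a b, ∃ y ∈ Ioo a b, u x < u y := by
    by_contra hcon
    push Not at hcon
    obtain ⟨z, hz⟩ := nonempty_Ioo.2 hab
    have hk : ∀ x ∈ Ioo a b, u x = u z := fun x hx => le_antisymm (hcon z hz x hx) (hcon x hx z hz)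
    have hzb : u z < u b := by
      refine lt_of_le_of_ne (hmono ⟨hz.1.le, hz.2.le⟩ (right_mem_Icc.2 hab.le) hz.2.le) fun he => ?_
      have hall : ∀ x ∈ Ioc a b, u x = u z := by
        intro x hx
        rcases hx.2.lt_or_eq with h1 | rfl
        · exact hk x ⟨hx.1, h1⟩
        · exact he.symm
      obtain ⟨x, hx, y, hy, hne⟩ := hu
      exact hne ((hall x hx).trans (hall y hy).symm)
    exact hr0 (hR.weighting_eq_zero hP hab (by omega) hh hk hzb hr)
  have hconv := hR.convexOn_weighting hP hab (by omega) hh hx hy hxy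
  have hconc := hR.concaveOn_utility hP (by omega) hh hconv hr hrpos
  have hxlty : x < y := by
    by_contra hle
    exact absurd (hmono ⟨hy.1.le, hy.2.le⟩ ⟨hx.1.le, hx.2.le⟩ (not_lt.1 hle)) (not_le.2 hxy)
  obtain ⟨l, hl, hlin⟩ := hh.linear_of_midpoint hconv fun s hs => by
    rcases hs.1.lt_or_eq with h1 | rfl
    · have := hR.weighting_midpoint hP hn hh hconv hconc hx.1 hxlty hy.2.le hxy (s := 0)
        (d := s / 2) le_rfl (by linarith) (by linarith [hs.2])
      rw [hh.zero, zero_add, zero_add, show 2 * (s / 2) = s by ring] at this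
      linarith
    · simp [hh.zero]
  refine ⟨hconc, l, ⟨lt_of_le_of_ne hl.1 fun h0 => ?_, hl.2⟩, hlin⟩
  rw [hlin r hr, ← h0, zero_mul] at hrpos
  exact lt_irrefl _ hrpos

/-! ### Iterated differences of convexity gaps -/

/-- The convexity gap `t f(x) - (s + t) f(x + s) + s f(x + s + t)`, differenced forward in `x`
with the steps listed in `L`. Nonnegativity of the gap itself is convexity of `f`. -/
def gapDiff (s t : ℝ) : List ℝ → (ℝ → ℝ) → ℝ → ℝ
  | [], f, x => t * f x - (s + t) * f (x + s) + s * f (x + s + t)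
  | d :: L, f, x => gapDiff s t L f (x + d) - gapDiff s t L f x

lemma gapDiff_const_mul (s t : ℝ) (L : List ℝ) (c : ℝ) (f : ℝ → ℝ) (x : ℝ) :
    gapDiff s t L (fun y => c * f y) x = c * gapDiff s t L f x := by
  induction L generalizing x with
  | nil => simp only [gapDiff]; ring
  | cons d L ih => simp only [gapDiff, ih]; ring

lemma gapDiff_neg (s t : ℝ) (L : List ℝ) (f : ℝ → ℝ) (x : ℝ) :
    gapDiff s t L (fun y => -f y) x = -gapDiff s t L f x := by
  have := gapDiff_const_mul s t L (-1) f x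
  simpa using this

/-- `gapDiff` is integration against a finite signed measure. -/
lemma exists_gapDiff_eq_sum {s t : ℝ} (hs : 0 < s) (ht : 0 < t) (L : List ℝ)
    (hL : ∀ d ∈ L, 0 < d) :
    ∃ (ι : Type) (_ : Fintype ι) (c e : ι → ℝ), (∀ i, e i ∈ Icc 0 (s + t + L.sum)) ∧
      ∀ f x, gapDiff s t L f x = ∑ i, c i * f (x + e i) := by
  induction L with
  | nil =>
    refine ⟨Fin 3, inferInstance, ![t, -(s + t), s], ![0, s, s + t], fun i => ?_, fun f x => ?_⟩
    · fin_cases i <;> simp <;> first | linarith | (constructor <;> linarith)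
    · simp [gapDiff, Fin.sum_univ_three, add_assoc]
      ring
  | cons d L ih =>
    obtain ⟨ι, hι, c, e, he, hce⟩ := ih fun d hd => hL d (List.mem_cons_of_mem _ hd)
    have hd := hL d List.mem_cons_self
    refine ⟨ι ⊕ ι, inferInstance, Sum.elim c (-c), Sum.elim (fun i => d + e i) e, ?_, ?_⟩
    · rintro (i | i)
      · have := he i
        simp only [Sum.elim_inl, List.sum_cons]
        exact ⟨by linarith [this.1], by linarith [this.2]⟩
      · have := he i
        simp only [Sum.elim_inr, List.sum_cons]
        exact ⟨this.1, by linarith [this.2]⟩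
    · intro f x
      simp only [gapDiff, hce, Fintype.sum_sum_type, Sum.elim_inl, Sum.elim_inr, Pi.neg_apply,
        neg_mul, Finset.sum_neg_distrib, add_assoc]
      ring

lemma hasDerivAt_gapDiff {s t : ℝ} (L : List ℝ) {f f' : ℝ → ℝ} (hf : ∀ x, HasDerivAt f (f' x) x)
    (x : ℝ) : HasDerivAt (gapDiff s t L f) (gapDiff s t L f' x) x := by
  induction L generalizing x with
  | nil =>
    exact (((hf x).const_mul t).sub (((hf (x + s)).comp_add_const x s).const_mul (s + t))).add
      ((((hf (x + s + t)).comp_add_const (x + s) t).comp_add_const x s).const_mul s)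
  | cons d L ih => exact ((ih (x + d)).comp_add_const x d).sub (ih x)

lemma convexOn_tpow_sub {j : ℕ} (η : ℝ) : ConvexOn ℝ univ fun x => tpow j (η - x) := by
  have h1 : ConvexOn ℝ univ fun x : ℝ => η - x := by
    refine ⟨convex_univ, fun x _ y _ p q _ _ hpq => le_of_eq ?_⟩
    simp only [smul_eq_mul]
    linear_combination (-η) * hpq
  have h2 : ConvexOn ℝ univ fun x : ℝ => max (η - x) 0 := h1.sup (convexOn_const 0 convex_univ)
  have h3 := (h2.pow (fun x _ => le_max_right _ _) j).smul
    (inv_nonneg.2 (Nat.cast_nonneg (α := ℝ) j.factorial))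
  refine h3.congr fun x _ => ?_
  simp only [tpow, Pi.pow_apply, smul_eq_mul]
  ring

lemma gap_nonneg_of_convexOn {S : Set ℝ} {f : ℝ → ℝ} (hf : ConvexOn ℝ S f) {s t x : ℝ}
    (hs : 0 < s) (ht : 0 < t) (hx : x ∈ S) (hx' : x + s + t ∈ S) :
    0 ≤ gapDiff s t [] f x := by
  have hst : 0 < s + t := by linarith
  have h1 := hf.2 hx hx' (div_nonneg ht.le hst.le) (div_nonneg hs.le hst.le) (by field_simp; ring)
  have e : (t / (s + t)) • x + (s / (s + t)) • (x + s + t) = x + s := by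
    simp only [smul_eq_mul]; field_simp; ring
  rw [e] at h1
  simp only [smul_eq_mul] at h1
  have h2 := mul_le_mul_of_nonneg_left h1 hst.le
  have e2 : (s + t) * (t / (s + t) * f x + s / (s + t) * f (x + s + t))
      = t * f x + s * f (x + s + t) := by field_simp
  rw [e2] at h2
  simp only [gapDiff]
  linarith

/-- Iterated gap differences of the truncated powers have alternating signs: differentiation lowers
the power, changes the sign and commutes with `gapDiff`. -/
lemma gapDiff_tpow_sign {s t : ℝ} (hs : 0 < s) (ht : 0 < t) (η : ℝ) (L : List ℝ)
    (hL : ∀ d ∈ L, 0 < d) {j : ℕ} (hj : L.length + 1 ≤ j) (x : ℝ) :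
    0 ≤ (-1 : ℝ) ^ L.length * gapDiff s t L (fun y => tpow j (η - y)) x := by
  induction L generalizing j x with
  | nil =>
    simpa using gap_nonneg_of_convexOn (convexOn_tpow_sub η) hs ht (mem_univ x) (mem_univ _)
  | cons d L ih =>
    rw [List.length_cons] at hj ⊢
    obtain ⟨i, rfl⟩ : ∃ i, j = i + 1 := ⟨j - 1, by omega⟩
    have ih' := fun x => ih (fun d hd => hL d (List.mem_cons_of_mem _ hd)) (j := i) (by omega) x
    have hd : ∀ x, HasDerivAt (fun x => (-1 : ℝ) ^ L.length *
        gapDiff s t L (fun y => tpow (i + 1) (η - y)) x)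
        ((-1 : ℝ) ^ L.length * gapDiff s t L (fun y => -tpow i (η - y)) x) x := fun x =>
      (hasDerivAt_gapDiff L (fun y => hasDerivAt_tpow_sub (by omega) η y) x).const_mul _
    have hanti := antitone_of_deriv_nonpos (fun x => (hd x).differentiableAt) fun x => by
      rw [(hd x).deriv, gapDiff_neg]
      linarith [ih' x]
    have := hanti (show x ≤ x + d by linarith [hL d List.mem_cons_self])
    simp only [gapDiff, pow_succ] at this ⊢
    linarith

/-- Iterated gap differences annihilate polynomials of low degree. -/
lemma gapDiff_pow_eq_zero {s t : ℝ} (b : ℝ) (L : List ℝ) {j : ℕ} (hj : j < L.length + 2) (x : ℝ) :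
    gapDiff s t L (fun y => (b - y) ^ j) x = 0 := by
  induction L generalizing j x with
  | nil =>
    simp only [List.length_nil] at hj
    interval_cases j <;> simp only [gapDiff] <;> ring
  | cons d L ih =>
    rw [List.length_cons] at hj
    simp only [gapDiff]
    cases j with
    | zero => rw [ih (by omega), ih (by omega), sub_zero]
    | succ i =>
      have hf : ∀ y : ℝ, HasDerivAt (fun y => (b - y) ^ (i + 1)) (-(i + 1) * (b - y) ^ i) y := by
        intro y
        refine (((hasDerivAt_id y).const_sub b).pow (i + 1)).congr_deriv ?_
        simp
        ring
      have hconst : ∀ x, HasDerivAt (gapDiff s t L fun y => (b - y) ^ (i + 1)) 0 x := fun x => by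
        have := hasDerivAt_gapDiff (s := s) (t := t) L hf x
        rwa [gapDiff_const_mul, ih (by omega), mul_zero] at this
      rw [is_const_of_deriv_eq_zero (fun x => (hconst x).differentiableAt)
        (fun x => (hconst x).deriv) (x + d) x, sub_self]

/-! ### Regularity from alternating gap differences -/

/-- Iterated gap differences of total order at most `m` have alternating signs on `(a, b)`. The gap
counts as order two and each forward difference as order one. -/
def AltConvex (a b : ℝ) (m : ℕ) (g : ℝ → ℝ) : Prop :=
  ∀ L : List ℝ, L.length + 2 ≤ m → (∀ d ∈ L, 0 < d) → ∀ s t : ℝ, 0 < s → 0 < t →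
    ∀ x, a < x → x + (s + t + L.sum) < b → 0 ≤ (-1 : ℝ) ^ L.length * gapDiff s t L g x

lemma AltConvex.convexOn {a b : ℝ} {m : ℕ} {g : ℝ → ℝ} (hm : 2 ≤ m) (hg : AltConvex a b m g) :
    ConvexOn ℝ (Ioo a b) g := by
  refine convexOn_of_slope_mono_adjacent (convex_Ioo a b) fun {x y z} hx hz hxy hyz => ?_
  have h1 : 0 < y - x := sub_pos.2 hxy
  have h2 : 0 < z - y := sub_pos.2 hyz
  have := hg [] (by simpa using hm) (by simp) (y - x) (z - y) h1 h2 x hx.1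
    (by simp only [List.sum_nil]; linarith [hz.2])
  simp only [gapDiff, List.length_nil, pow_zero, one_mul] at this
  rw [show x + (y - x) = y by ring, show y + (z - y) = z by ring] at this
  rw [div_le_div_iff₀ h1 h2]
  linarith

lemma hasDerivWithinAt_shift {f : ℝ → ℝ} {f' x c : ℝ}
    (hf : HasDerivWithinAt f f' (Ioi (x + c)) (x + c)) :
    HasDerivWithinAt (fun y => f (y + c)) f' (Ioi x) x := by
  have h1 : HasDerivWithinAt (fun y : ℝ => y + c) 1 (Ioi x) x :=
    ((hasDerivAt_id x).add_const c).hasDerivWithinAt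
  have := HasDerivWithinAt.comp x hf h1 fun y (hy : x < y) => by
    simpa using hy
  simpa [Function.comp_def] using this

lemma hasDerivWithinAt_gapDiff {s t : ℝ} (hs : 0 < s) (ht : 0 < t) (L : List ℝ)
    (hL : ∀ d ∈ L, 0 < d) {f f' : ℝ → ℝ} (x : ℝ)
    (hf : ∀ y ∈ Icc x (x + (s + t + L.sum)), HasDerivWithinAt f (f' y) (Ioi y) y) :
    HasDerivWithinAt (gapDiff s t L f) (gapDiff s t L f' x) (Ioi x) x := by
  induction L generalizing x with
  | nil =>
    simp only [List.sum_nil, add_zero] at hf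
    exact (((hf x ⟨le_rfl, by linarith⟩).const_mul t).sub ((hasDerivWithinAt_shift
      (hf (x + s) ⟨by linarith, by linarith⟩)).const_mul (s + t))).add
      ((hasDerivWithinAt_shift (f := fun y => f (y + t)) (hasDerivWithinAt_shift
        (hf (x + s + t) ⟨by linarith, by linarith⟩))).const_mul s)
  | cons d L ih =>
    have hd := hL d List.mem_cons_self
    have hL' : ∀ d ∈ L, 0 < d := fun d hd => hL d (List.mem_cons_of_mem _ hd)
    simp only [List.sum_cons] at hf
    exact (hasDerivWithinAt_shift (ih hL' (x + d) fun y hy => hf y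
      ⟨by linarith [hy.1], by linarith [hy.2]⟩)).sub
      (ih hL' x fun y hy => hf y ⟨hy.1, by linarith [hy.2]⟩)

/-- One degree of smoothness: the right derivative inherits the sign conditions, so it is concave
and hence continuous, so it is the derivative. -/
lemma AltConvex.hasDeriv {a b : ℝ} {m : ℕ} {g : ℝ → ℝ} (hm : 2 ≤ m) (hg : AltConvex a b (m + 1) g) :
    (∀ x ∈ Ioo a b, DifferentiableAt ℝ g x) ∧ AltConvex a b m fun x => -deriv g x := by
  have hconv := hg.convexOn (by omega)
  have hint : interior (Ioo a b) = Ioo a b := isOpen_Ioo.interior_eq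
  set r : ℝ → ℝ := fun x => derivWithin g (Ioi x) x with hr
  have hrd : ∀ x ∈ Ioo a b, HasDerivWithinAt g (r x) (Ioi x) x := fun x hx =>
    hconv.hasDerivWithinAt_rightDeriv_of_mem_interior (by rwa [hint])
  have hralt : AltConvex a b m fun x => -r x := by
    intro L hLm hL s t hs ht x hxa hxb
    have hsum : 0 ≤ L.sum := List.sum_nonneg fun d hd => (hL d hd).le
    have hder := hasDerivWithinAt_gapDiff hs ht L hL x fun y hy =>
      hrd y ⟨hxa.trans_le hy.1, hy.2.trans_lt hxb⟩
    rw [hasDerivWithinAt_iff_tendsto_slope' (self_notMem_Ioi)] at hder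
    have hlim := hder.const_mul ((-1 : ℝ) ^ (L.length + 1))
    rw [gapDiff_neg]
    have : (-1 : ℝ) ^ L.length * -gapDiff s t L r x
        = (-1 : ℝ) ^ (L.length + 1) * gapDiff s t L r x := by ring
    rw [this]
    refine ge_of_tendsto hlim ?_
    have hnear : Ioo x (b - (s + t + L.sum)) ∈ 𝓝[>] x := Ioo_mem_nhdsGT (by linarith)
    filter_upwards [hnear] with y hy
    have hpos : 0 < y - x := sub_pos.2 hy.1
    have h1 := hg ((y - x) :: L) (by simp only [List.length_cons]; omega)
      (by simpa [hpos] using hL) s t hs ht x hxa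
      (by simp only [List.sum_cons]; linarith [hy.2])
    simp only [gapDiff, List.length_cons] at h1
    rw [show x + (y - x) = y by ring] at h1
    rw [slope_def_field, mul_div_assoc']
    exact div_nonneg h1 hpos.le
  have hrcont : ContinuousOn (fun x => -r x) (Ioo a b) :=
    (hralt.convexOn hm).continuousOn isOpen_Ioo
  have hdiff : ∀ x ∈ Ioo a b, HasDerivAt g (r x) x := by
    intro x hx
    have hl := hconv.hasDerivWithinAt_leftDeriv_of_mem_interior (x := x) (by rwa [hint])
    have hle := hconv.leftDeriv_le_rightDeriv_of_mem_interior (x := x) (by rwa [hint])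
    have hge : r x ≤ derivWithin g (Iio x) x := by
      have hcr : Tendsto r (𝓝[<] x) (𝓝 (r x)) := by
        have h1 : ContinuousAt (fun y => -r y) x := hrcont.continuousAt (Ioo_mem_nhds hx.1 hx.2)
        have h2 : Tendsto (fun y => - -r y) (𝓝 x) (𝓝 (- -r x)) := h1.tendsto.neg
        simp only [neg_neg] at h2
        exact h2.mono_left nhdsWithin_le_nhds
      refine le_of_tendsto hcr ?_
      filter_upwards [Ioo_mem_nhdsLT hx.1] with y hy
      have hy' : y ∈ Ioo a b := ⟨hy.1, hy.2.trans hx.2⟩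
      exact (hconv.rightDeriv_le_slope_of_mem_interior (by rwa [hint]) hx hy.2).trans
        (hconv.slope_le_leftDeriv_of_mem_interior hy' (by rwa [hint]) hy.2)
    have he : derivWithin g (Iio x) x = r x := le_antisymm hle hge
    rw [he] at hl
    have hun := hl.union (hrd x hx)
    rw [Iio_union_Ioi] at hun
    rw [hasDerivAt_iff_tendsto_slope]
    rwa [hasDerivWithinAt_iff_tendsto_slope' (by simp)] at hun
  refine ⟨fun x hx => (hdiff x hx).differentiableAt, ?_⟩
  -- the condition only involves values in `(a, b)`, where `deriv g = r`
  intro L hLm hL s t hs ht x hxa hxb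
  have h1 := hralt L hLm hL s t hs ht x hxa hxb
  obtain ⟨ι, _, c, e, he, hce⟩ := exists_gapDiff_eq_sum hs ht L hL
  rw [hce] at h1 ⊢
  have : ∀ i, deriv g (x + e i) = r (x + e i) := fun i =>
    (hdiff _ ⟨by linarith [(he i).1], by linarith [(he i).2]⟩).deriv
  simpa only [this] using h1

/-- The Boas-Widder phenomenon: an increasing concave function whose iterated gap differences
alternate in sign is `n`-monotone. -/
theorem isNMonotone_of_altConvex {a b : ℝ} {n : ℕ} (hn : 2 ≤ n) {u : ℝ → ℝ}
    (hmono : MonotoneOn u (Icc a b)) (hconc : ConcaveOn ℝ (Icc a b) u)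
    (hu : AltConvex a b n fun x => -u x) : IsNMonotone n a b u := by
  set G : ℕ → ℝ → ℝ := fun k x => (-1 : ℝ) ^ (k + 1) * iteratedDeriv k u x with hG
  have hG' : ∀ k, (fun x => -deriv (G k) x) = G (k + 1) := by
    intro k
    funext x
    simp only [hG]
    rw [deriv_const_mul_field, iteratedDeriv_succ, pow_succ (-1 : ℝ) (k + 1)]
    ring
  have halt : ∀ k, k + 2 ≤ n → AltConvex a b (n - k) (G k) := by
    intro k
    induction k with
    | zero =>
      intro _
      have : G 0 = fun x => -u x := by funext x; simp [hG]
      rw [this]; exact hu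
    | succ k ih =>
      intro hk
      have h1 := ih (by omega)
      rw [show n - k = (n - (k + 1)) + 1 by omega] at h1
      have := (h1.hasDeriv (by omega)).2
      rwa [hG'] at this
  have hdiff : ∀ k, k + 3 ≤ n → ∀ x ∈ Ioo a b, DifferentiableAt ℝ (G k) x := by
    intro k hk
    have h1 := halt k (by omega)
    rw [show n - k = (n - (k + 1)) + 1 by omega] at h1
    exact (h1.hasDeriv (by omega)).1
  have hconv : ∀ k, k + 2 ≤ n → ConvexOn ℝ (Ioo a b) (G k) := fun k hk =>
    (halt k hk).convexOn (by omega)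
  have hanti : ∀ k, k + 2 ≤ n → AntitoneOn (G k) (Ioo a b) := by
    intro k hk
    cases k with
    | zero =>
      intro x hx y hy hxy
      simpa [hG] using hmono (Ioo_subset_Icc_self hx) (Ioo_subset_Icc_self hy) hxy
    | succ k =>
      have := ((hconv k (by omega)).monotoneOn_deriv (hdiff k (by omega))).neg
      rw [← hG']
      exact this
  refine ⟨hmono, fun _ => ⟨hconc, fun k hk x hx => ?_, ?_, ?_⟩⟩
  · rw [Finset.mem_Icc] at hk
    obtain ⟨i, rfl⟩ : ∃ i, k = i + 1 := ⟨k - 1, by omega⟩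
    rw [Nat.add_sub_cancel]
    have hd := hdiff i (by omega) x hx
    have hne : ((-1 : ℝ) ^ (i + 1)) ≠ 0 := by positivity
    refine ⟨?_, ?_⟩
    · have h2 := hd.const_mul ((-1 : ℝ) ^ (i + 1))⁻¹
      refine h2.congr_of_eventuallyEq (Eventually.of_forall fun y => ?_)
      simp only [hG]
      rw [inv_mul_cancel_left₀ hne]
    · have h3 : (-1 : ℝ) ^ i * iteratedDeriv (i + 1) u x = G (i + 1) x := by
        simp only [hG]; ring
      rw [h3, ← hG']
      have hle : deriv (G i) x ≤ 0 := by
        have h4 := (hanti i (by omega)).derivWithin_nonpos (x := x)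
        rwa [derivWithin_of_isOpen isOpen_Ioo hx] at h4
      simpa using hle
  · have := hanti (n - 2) (by omega)
    simp only [hG] at this
    rwa [show n - 2 + 1 = n - 1 by omega] at this
  · have := hconv (n - 2) (by omega)
    simp only [hG] at this
    rwa [show n - 2 + 1 = n - 1 by omega] at this

/-! ### Necessity of `n`-monotonicity -/

/-- If `h` is linear with a jump at `1`, dominated pairs sharing an atom at `a` compare expected
utilities; here the pair is given by the positive and negative parts of a signed measure. -/
theorem Respects.signed_sum_nonneg [IsProbabilityMeasure P] (hP : SupportsUniform P) {a b : ℝ}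
    (hab : a < b) {n : ℕ} {u h : ℝ → ℝ} (hh : IsWeighting h) (hR : Respects P a b n u h)
    {l : ℝ} (hl : 0 < l)
    (hlin : ∀ s ∈ Icc (0 : ℝ) 1, h s = l * s + (1 - l) * (if s = 1 then 1 else 0))
    {ι : Type} [Fintype ι] (x C : ι → ℝ) (hx : ∀ i, x i ∈ Icc a b) (hC : ∑ i, C i = 0) {k : ℕ}
    (hk : 2 ≤ k) (hkn : k ≤ n) (hdom : ∀ η ∈ Icc a b, ∑ i, C i * tpow (k - 1) (η - x i) ≤ 0)
    (hb : ∀ j ∈ Finset.Icc 1 (k - 1), ∑ i, C i * tpow j (b - x i) ≤ 0) :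
    0 ≤ ∑ i, C i * u (x i) := by
  have hu := hR.monotoneOn (by omega) hh
  set p : ι → ℝ := fun i => max (C i) 0 with hp
  set q : ι → ℝ := fun i => max (-C i) 0 with hq
  have hpq : ∀ i, p i - q i = C i := fun i => by
    simp only [hp, hq]
    rcases le_total (C i) 0 with h0 | h0
    · rw [max_eq_right h0, max_eq_left (by linarith)]; ring
    · rw [max_eq_left h0, max_eq_right (by linarith)]; ring
  have hp0 : ∀ i, 0 ≤ p i := fun i => le_max_right _ _
  have hq0 : ∀ i, 0 ≤ q i := fun i => le_max_right _ _
  have hsub : ∀ f : ι → ℝ, ∑ i, p i * f i - ∑ i, q i * f i = ∑ i, C i * f i := fun f => by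
    rw [← Finset.sum_sub_distrib]
    exact Finset.sum_congr rfl fun i _ => by rw [← hpq i]; ring
  have hmass : ∑ i, p i = ∑ i, q i := by
    have := hsub fun _ => 1
    simp only [mul_one, hC] at this
    linarith
  have hm0 : 0 ≤ ∑ i, p i := Finset.sum_nonneg fun i _ => hp0 i
  set M := ∑ i, p i + 1 with hM
  have hM0 : 0 < M := by linarith
  -- scale to total mass less than one and put the remaining mass at `a`
  set ext : (ι → ℝ) → Option ι → ℝ := fun r o => o.elim (1 / M) (fun i => r i / M) with hext
  set y : Option ι → ℝ := fun o => o.elim a x with hy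
  have hyI : ∀ o, y o ∈ Icc a b := by
    rintro (_ | i)
    · exact left_mem_Icc.2 hab.le
    · exact hx i
  have hsum : ∀ (r : ι → ℝ) (f : Option ι → ℝ), ∑ o, ext r o * f o
      = 1 / M * f none + (∑ i, r i * f (some i)) / M := by
    intro r f
    rw [Fintype.sum_option, Finset.sum_div]
    simp only [hext, Option.elim_none, Option.elim_some]
    congr 1
    exact Finset.sum_congr rfl fun i _ => by ring
  have hone : ∀ r : ι → ℝ, ∑ i, r i = ∑ i, p i → ∑ o, ext r o = 1 := by
    intro r hr
    have := hsum r fun _ => 1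
    simp only [mul_one] at this
    rw [this, hr]
    field_simp
    rw [hM]; ring
  have hext0 : ∀ r : ι → ℝ, (∀ i, 0 ≤ r i) → ∀ o, 0 ≤ ext r o := by
    intro r hr o
    cases o with
    | none => simp only [hext, Option.elim_none]; positivity
    | some i => simp only [hext, Option.elim_some]; exact div_nonneg (hr i) hM0.le
  have hcmp : ∀ f : Option ι → ℝ, ∑ i, C i * f (some i) ≤ 0 →
      ∑ o, ext p o * f o ≤ ∑ o, ext q o * f o := by
    intro f hf
    rw [hsum, hsum]
    have := hsub fun i => f (some i)
    have h2 : (∑ i, p i * f (some i)) / M ≤ (∑ i, q i * f (some i)) / M :=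
      div_le_div_of_nonneg_right (by linarith) hM0.le
    linarith
  obtain ⟨X, Y, Z, W, hXY, hX, hY, -, -, hZr, hWr, hZi, hWi⟩ :=
    exists_stochDom hP y hyI (ext p) (ext q) (hext0 p hp0) (hone p rfl) (hext0 q hq0)
      (hone q hmass.symm) hk (fun η hη => hcmp (fun o => tpow (k - 1) (η - y o)) (hdom η hη))
      (fun j hj => hcmp (fun o => tpow j (b - y o)) (hb j hj))
  have hmin : ∀ (X : RandVar Ω a b) (Z : Ω → Option ι) (r : ι → ℝ), (∀ i, 0 ≤ r i) →
      (∀ ω, X.1 ω = y (Z ω)) → (∀ s, P.real (Z ⁻¹' s) = ∑ o, s.indicator (ext r) o) →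
      essMin P (fun ω => u (X.1 ω)) = u a := by
    intro X Z r hr hX hZ
    have hA := le_comp_randVar hu X
    refine le_antisymm (csInf_le (bddBelow_distFun_pos hA) ?_) (le_essMin hA (comp_randVar_le hu X))
    have h1 : P.real (Z ⁻¹' {none}) ≤ distFun P (fun ω => u (X.1 ω)) (u a) :=
      measureReal_mono fun ω (hω : Z ω = none) => by
        change u (X.1 ω) ≤ u a
        rw [hX, hω]
        exact le_rfl
    refine lt_of_lt_of_le ?_ h1
    rw [hZ]
    refine lt_of_lt_of_le (b := ({none} : Set (Option ι)).indicator (ext r) none) ?_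
      (Finset.single_le_sum (f := fun o => ({none} : Set (Option ι)).indicator (ext r) o)
        (fun o _ => indicator_nonneg (fun o _ => hext0 r hr o) o) (Finset.mem_univ none))
    rw [indicator_of_mem (mem_singleton _)]
    simp only [hext, Option.elim_none]
    positivity
  have h1 := hR X Y (hXY.mono (by omega) hkn)
  rw [rdu_eq_of_monotoneOn hab.le hh hu hlin X, rdu_eq_of_monotoneOn hab.le hh hu hlin Y,
    hmin X Z p hp0 hX hZr, hmin Y W q hq0 hY hWr] at h1
  simp_rw [hX, hY] at h1
  rw [hZi fun o => u (y o), hWi fun o => u (y o), hsum, hsum] at h1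
  have h2 : (∑ i, q i * u (x i)) / M ≤ (∑ i, p i * u (x i)) / M := by
    have := le_of_mul_le_mul_left (le_of_add_le_add_right h1) hl
    simpa [hy] using this
  have h3 := (div_le_div_iff_of_pos_right hM0).1 h2
  have h4 := hsub fun i => u (x i)
  linarith

/-- The finite tests above contain the iterated gap differences of all orders up to `n`. -/
theorem Respects.altConvex [IsProbabilityMeasure P] (hP : SupportsUniform P) {a b : ℝ}
    (hab : a < b) {n : ℕ} {u h : ℝ → ℝ} (hh : IsWeighting h) (hR : Respects P a b n u h)
    {l : ℝ} (hl : 0 < l)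
    (hlin : ∀ s ∈ Icc (0 : ℝ) 1, h s = l * s + (1 - l) * (if s = 1 then 1 else 0)) :
    AltConvex a b n fun x => -u x := by
  intro L hLn hL s t hs ht x hxa hxb
  obtain ⟨ι, _, c, e, he, hce⟩ := exists_gapDiff_eq_sum hs ht L hL
  have hxe : ∀ i, x + e i ∈ Icc a b := fun i =>
    ⟨by linarith [(he i).1], by linarith [(he i).2]⟩
  set σ : ℝ := (-1) ^ L.length with hσ
  have hC : ∀ f : ℝ → ℝ, ∑ i, (-(σ * c i)) * f (x + e i) = -(σ * gapDiff s t L f x) := by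
    intro f
    rw [hce, Finset.mul_sum, ← Finset.sum_neg_distrib]
    exact Finset.sum_congr rfl fun i _ => by ring
  -- the moments up to order `k - 1` of the two laws agree at `b`, where `k = L.length + 2`
  have hpow : ∀ j, j < L.length + 2 → ∑ i, (-(σ * c i)) * tpow j (b - (x + e i)) = 0 := by
    intro j hj
    have e1 : ∀ i, tpow j (b - (x + e i)) = (j.factorial : ℝ)⁻¹ * (b - (x + e i)) ^ j := fun i => by
      rw [tpow_of_nonneg _ (by linarith [(hxe i).2])]; ring
    simp_rw [e1]
    rw [hC fun y => (j.factorial : ℝ)⁻¹ * (b - y) ^ j, gapDiff_const_mul,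
      gapDiff_pow_eq_zero b L hj]
    simp
  have key := hR.signed_sum_nonneg hP hab hh hl hlin (fun i => x + e i) (fun i => -(σ * c i)) hxe
    (by simpa [tpow] using hpow 0 (by omega)) (k := L.length + 2) (by omega) hLn
    (fun η _ => by
      rw [hC fun y => tpow (L.length + 2 - 1) (η - y)]
      have := gapDiff_tpow_sign hs ht η L hL (j := L.length + 2 - 1) (by omega) x
      linarith)
    (fun j hj => (hpow j (by rw [Finset.mem_Icc] at hj; omega)).le)
  rw [hC u] at key
  rw [gapDiff_neg]
  linarith

end RDU

end

/-! ### The characterization -/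

theorem theorem1 {Ω : Type*} [MeasurableSpace Ω] (P : Measure Ω) [IsProbabilityMeasure P]
    (hP : RDU.SupportsUniform P) (a b : ℝ) (hab : a < b) (n : ℕ) (hn : 3 ≤ n)
    (u h : ℝ → ℝ) (hu : ∃ x ∈ Ioc a b, ∃ y ∈ Ioc a b, u x ≠ u y) (hh : RDU.IsWeighting h)
    (pref : RDU.RandVar Ω a b → RDU.RandVar Ω a b → Prop) (hpref : RDU.AdmitsRDU P pref u h) :
    (RDU.Consistent P n pref ↔
      (RDU.CaseOne a b u h ∨ ∃ l : ℝ, RDU.CaseTwo n a b u h l)) ∧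
    (RDU.CaseOne a b u h →
      ∀ X : RDU.RandVar Ω a b, RDU.rdu P u h X = RDU.essMin P (fun ω => u (X.1 ω))) ∧
    (∀ l : ℝ, RDU.CaseTwo n a b u h l →
      ∀ X : RDU.RandVar Ω a b,
        RDU.rdu P u h X =
          l * (∫ ω, u (X.1 ω) ∂P) + (1 - l) * RDU.essMin P (fun ω => u (X.1 ω))) := by
  refine ⟨⟨fun hcons => ?_, fun hc X Y hXY => ?_⟩, fun hc X => ?_, fun l hc X => ?_⟩
  · have hR : RDU.Respects P a b n u h := fun X Y hXY => (hpref X Y).1 (hcons X Y hXY)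
    have hmono := hR.monotoneOn (by omega) hh
    rcases hR.dichotomy hP hab hn hu hh with h0 | ⟨hconc, l, hl, hlin⟩
    · refine Or.inl ⟨hmono, fun s hs => ?_⟩
      split_ifs with h1
      · rw [h1, hh.one]
      · exact h0 s ⟨hs.1, lt_of_le_of_ne hs.2 h1⟩
    · have hlin' : ∀ s ∈ Icc (0 : ℝ) 1, h s = l * s + (1 - l) * (if s = 1 then 1 else 0) := by
        intro s hs
        split_ifs with h1
        · rw [h1, hh.one]; ring
        · rw [hlin s ⟨hs.1, lt_of_le_of_ne hs.2 h1⟩]; ring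
      refine Or.inr ⟨l, hl, RDU.isNMonotone_of_altConvex (by omega) hmono hconc
        (hR.altConvex hP hab hh hl.1 hlin'), fun s hs => ?_⟩
      rcases hs.2.lt_or_eq with h1 | rfl
      · rw [hlin s ⟨hs.1, h1⟩, if_pos h1, if_neg h1.ne]; ring
      · simp [hh.one]
  · exact (hpref X Y).2 (RDU.rdu_le_of_stochDom hab hn hh hc hXY)
  · simpa using RDU.rdu_eq_of_monotoneOn hab.le hh hc.1 hc.weighting_eq X
  · exact RDU.rdu_eq_of_monotoneOn hab.le hh hc.2.1.1 hc.weighting_eq X
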